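/- Let $n,d\ge 1$ be integers and $\mathcal V=\{1,\dots,n\}$. For $p\in[1,\infty)$ let $\mathcal P_p(\mathbb R^d)$ be the set of Borel probability measures $\mu$ on $\mathbb R^d$ with $\int |x|^p\,d\mu<\infty$, let $\mathcal P_{p,ac}(\mathbb R^d)$ be the set of those that are absolutely continuous with respect to Lebesgue measure, and let $W_p(\mu,\nu)=\min_{\gamma}\left(\int|x-y|^p\,d\gamma(x,y)\right)^{1/p}$, where $\gamma$ ranges over the probability measures on $\mathbb R^d\times\mathbb R^d$ with marginals $\mu$ and $\nu$. For every $t\in\mathbb N_0=\{0,1,2,\dots\}$ let $\mathcal E(t)\subset\mathcal V\times\mathcal V$ be symmetric with $(i,i)\in\mathcal E(t)$ for all $i\in\mathcal V$, let $\mathcal N_i(t)=\{j\in\mathcal V:(i,j)\in\mathcal E(t)\}$, and let $(w_{ij}(t))_{i,j\in\mathcal V}$ be real weights such that $w_{ij}(t)>0$ if and only if $j\in\mathcal N_i(t)$, $w_{ij}(t)=0$ otherwise, and $\sum_{j\in\mathcal N_i(t)}w_{ij}(t)=1$. Assume that (a) there is $\delta\in(0,1)$ such that $w_{ij}(t)\ge\delta$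 for all $t\in\mathbb N_0$, $i\in\mathcal V$ and $j\in\mathcal N_i(t)$; (b) there are integers $0=\tau_0<\tau_1<\tau_2<\cdots$ with $\sup_k(\tau_{k+1}-\tau_k)<\infty$ such that for every $k\in\mathbb N_0$ the graph $\left(\mathcal V,\ \bigcup_{t=\tau_k}^{\tau_{k+1}-1}\mathcal E(t)\right)$ is connected. Let $\mu_1(0),\dots,\mu_n(0)\in\mathcal P_{q,ac}(\mathbb R^d)$ for some $q\in(2,\infty)$, and suppose that for all $t\in\mathbb N_0$ and $i\in\mathcal V$ the measure $\mu_i(t+1)$ is the Wasserstein barycenter $$\mu_i(t+1)=\underset{\nu\in\mathcal P_2(\mathbb R^d)}{\operatorname{argmin}}\ \sum_{j\in\mathcal N_i(t)}w_{ij}(t)\,W_2^2(\mu_j(t),\nu).$$ Then there exists $\mu^*\in\mathcal P_2(\mathbb R^d)$ such that $\lim_{t\to\infty}W_2(\mu_i(t),\mu^*)=0$ for all $i\in\mathcal V$. -/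

import Mathlib

open MeasureTheory Filter Topology
open scoped ENNReal

/-- `𝒫_p(ℝ^d)`: Borel probability measures on Euclidean `ℝ^d` with finite `p`-th moment. -/
def WassersteinSpace (d : ℕ) (p : ℝ) : Set (Measure (EuclideanSpace ℝ (Fin d))) :=
  {μ | IsProbabilityMeasure μ ∧ ∫⁻ x, ‖x‖ₑ ^ p ∂μ < ∞}

/-- `𝒫_{p,ac}(ℝ^d)`: the members of `𝒫_p(ℝ^d)` that are absolutely continuous with respect to
Lebesgue measure. -/
def WassersteinSpaceAC (d : ℕ) (p : ℝ) : Set (Measure (EuclideanSpace ℝ (Fin d))) :=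
  {μ | μ ∈ WassersteinSpace d p ∧ μ ≪ volume}

/-- `Π(μ, ν)`: the transport plans from `μ` to `ν`. -/
def transportPlans {d : ℕ} (μ ν : Measure (EuclideanSpace ℝ (Fin d))) :
    Set (Measure (EuclideanSpace ℝ (Fin d) × EuclideanSpace ℝ (Fin d))) :=
  {γ | IsProbabilityMeasure γ ∧ γ.map Prod.fst = μ ∧ γ.map Prod.snd = ν}

/-- The `p`-Wasserstein distance, valued in `[0, ∞]` (it is finite on `𝒫_p(ℝ^d)`). -/
noncomputable def wassersteinDist {d : ℕ} (p : ℝ)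
    (μ ν : Measure (EuclideanSpace ℝ (Fin d))) : ℝ≥0∞ :=
  ⨅ γ ∈ transportPlans μ ν, (∫⁻ z, ‖z.1 - z.2‖ₑ ^ p ∂γ) ^ (1 / p)

/-- `∑_{j ∈ J} λ_j W_2²(m_j, ν)`. -/
noncomputable def barycenterCost {d : ℕ} {ι : Type*} (J : Finset ι)
    (m : ι → Measure (EuclideanSpace ℝ (Fin d))) (lam : ι → ℝ)
    (ν : Measure (EuclideanSpace ℝ (Fin d))) : ℝ≥0∞ :=
  ∑ j ∈ J, ENNReal.ofReal (lam j) * wassersteinDist 2 (m j) ν ^ 2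

/-- `bar({(m_j, λ_j)}_{j ∈ J})`, as the set of minimizers over `𝒫_2(ℝ^d)` of
`ν ↦ ∑_{j ∈ J} λ_j W_2²(m_j, ν)`. -/
def barycenters {d : ℕ} {ι : Type*} (J : Finset ι)
    (m : ι → Measure (EuclideanSpace ℝ (Fin d))) (lam : ι → ℝ) :
    Set (Measure (EuclideanSpace ℝ (Fin d))) :=
  {ν | ν ∈ WassersteinSpace d 2 ∧ IsMinOn (barycenterCost J m lam) (WassersteinSpace d 2) ν}

open Classical in
/-- The neighbors `{j : (i, j) ∈ E}` of `i` for the link set `E`. -/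
noncomputable def neighbors {n : ℕ} (E : Set (Fin n × Fin n)) (i : Fin n) : Finset (Fin n) :=
  Finset.univ.filter fun j => (i, j) ∈ E

/-- The graphs with link sets `E t`, `t ∈ T`, are jointly connected: their union is a connected
graph. (Passing to `SimpleGraph` only discards self-loops.) -/
def JointlyConnected {n : ℕ} (E : ℕ → Set (Fin n × Fin n)) (T : Set ℕ) : Prop :=
  (SimpleGraph.fromRel fun i j : Fin n => (i, j) ∈ ⋃ t ∈ T, E t).Connected

/-! A barycenter is, up to an arbitrarily small L² error, the law of a weighted average of random
variables with the given laws. Hence Jensen's inequality holds along the dynamics: for convex `f` of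
at most quadratic growth, the numbers `∫ f dμ_i(t)` satisfy `V_i(t+1) ≤ ∑_j w_ij(t) V_j(t)`
(`QuadraticConvex.integral_barycenter_le`). Nonnegative solutions of this inequality over jointly
connected graphs reach consensus: their maximum never increases, and an agent far below it drags
every agent below it within a bounded time (`tendsto_of_le_weighted_sum`). So `∫ f dμ_i(t)`
converges, to a limit independent of `i`.

Cosines of linear forms are, up to constants, differences of such `f`. The characteristic functions
therefore converge to a common limit, and bounded second moments give tightness, hence weak
convergence to one law (`exists_common_limit`). The functions `max (‖x‖ - R) 0 ^ 2` are also convex,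
so their integrals never exceed the initial maximum. This makes the second moments uniformly
integrable and upgrades weak convergence to `W₂` (`tendsto_wassersteinDist_two`). Near-optimal plans
suffice throughout; no optimal plan or map is needed. -/

/-! ### Gluing of plans and elementary bounds on the transport cost. -/

open ProbabilityTheory in
/-- **Gluing lemma**: transport plans with a common second marginal are the joint laws of
random variables `(Y j, X)` on one probability space. -/
theorem exists_gluing {E ι : Type} [MeasurableSpace E] [StandardBorelSpace E] [Nonempty E]
    [Fintype ι] (ν : Measure E) [IsProbabilityMeasure ν] (γ : ι → Measure (E × E))
    [∀ j, IsProbabilityMeasure (γ j)] (hγ : ∀ j, (γ j).map Prod.snd = ν) :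
    ∃ (Ω : Type) (_ : MeasurableSpace Ω) (P : Measure Ω) (X : Ω → E) (Y : ι → Ω → E),
      IsProbabilityMeasure P ∧ Measurable X ∧ (∀ j, Measurable (Y j)) ∧
        ∀ j, P.map (fun ω => (Y j ω, X ω)) = γ j := by
  -- Each plan is disintegrated over its second marginal, and the conditional law of the first
  -- coordinate is written as a function of uniform noise. One noise variable per `j`, independent
  -- of a shared `X`, then builds all the `Y j` together.
  have hex : ∀ j, ∃ f : E → unitInterval → E, Measurable (Function.uncurry f) ∧
      ∀ a, volume.map (f a) = ((γ j).map Prod.swap).condKernel a := by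
    intro j
    have : IsProbabilityMeasure ((γ j).map Prod.swap) :=
      Measure.isProbabilityMeasure_map measurable_swap.aemeasurable
    exact Kernel.exists_measurable_map_eq_unitInterval _
  choose f hf hfmap using hex
  refine ⟨E × (ι → unitInterval), inferInstance, ν.prod (Measure.pi fun _ => volume), Prod.fst,
    fun j ω => f j ω.1 (ω.2 j), inferInstance, measurable_fst, fun j => ?_, fun j => ?_⟩
  · exact (hf j).comp (measurable_fst.prodMk ((measurable_pi_apply j).comp measurable_snd))
  have : IsProbabilityMeasure ((γ j).map Prod.swap) :=
    Measure.isProbabilityMeasure_map measurable_swap.aemeasurable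
  have hfst : ((γ j).map Prod.swap).fst = ν := by
    rw [Measure.fst, Measure.map_map measurable_fst measurable_swap]
    exact hγ j
  have hYm : Measurable fun ω : E × (ι → unitInterval) => f j ω.1 (ω.2 j) :=
    (hf j).comp (measurable_fst.prodMk ((measurable_pi_apply j).comp measurable_snd))
  ext s hs
  have hs' : MeasurableSet (Prod.swap ⁻¹' s) := measurable_swap hs
  rw [Measure.map_apply (hYm.prodMk measurable_fst) hs,
    Measure.prod_apply ((hYm.prodMk measurable_fst) hs)]
  have h1 : (γ j) s = ((γ j).map Prod.swap) (Prod.swap ⁻¹' s) := by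
    rw [Measure.map_apply measurable_swap hs', ← Set.preimage_comp]; simp
  rw [h1, ← Measure.lintegral_condKernel_mem hs', hfst]
  refine lintegral_congr fun a => ?_
  rw [← hfmap j a]
  have hfa : Measurable (f j a) := (hf j).comp measurable_prodMk_left
  have h2 : MeasurableSet {b | (a, b) ∈ Prod.swap ⁻¹' s} := measurable_prodMk_left hs'
  rw [Measure.map_apply hfa h2]
  have h3 := (measurePreserving_eval (fun _ : ι => (volume : Measure unitInterval)) j).measure_preimage
    (hfa h2).nullMeasurableSet
  rw [← h3]
  rfl

theorem wassersteinDist_two_sq_le {d : ℕ} {μ ν : Measure (EuclideanSpace ℝ (Fin d))}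
    {γ : Measure (EuclideanSpace ℝ (Fin d) × EuclideanSpace ℝ (Fin d))}
    (hγ : γ ∈ transportPlans μ ν) :
    wassersteinDist 2 μ ν ^ 2 ≤ ∫⁻ z, ‖z.1 - z.2‖ₑ ^ 2 ∂γ := by
  have h : wassersteinDist 2 μ ν ≤ (∫⁻ z, ‖z.1 - z.2‖ₑ ^ (2 : ℝ) ∂γ) ^ (1 / 2 : ℝ) :=
    iInf₂_le γ hγ
  calc wassersteinDist 2 μ ν ^ 2
      ≤ ((∫⁻ z, ‖z.1 - z.2‖ₑ ^ (2 : ℝ) ∂γ) ^ (1 / 2 : ℝ)) ^ 2 := by gcongr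
    _ = _ := by
      rw [← ENNReal.rpow_natCast, ← ENNReal.rpow_mul]
      norm_num

theorem exists_transportPlan_lt {d : ℕ} {μ ν : Measure (EuclideanSpace ℝ (Fin d))} {c : ℝ≥0∞}
    (h : wassersteinDist 2 μ ν ^ 2 < c) :
    ∃ γ ∈ transportPlans μ ν, ∫⁻ z, ‖z.1 - z.2‖ₑ ^ 2 ∂γ < c := by
  have h2 : wassersteinDist 2 μ ν < c ^ (1 / 2 : ℝ) := by
    rw [one_div, ENNReal.lt_rpow_inv_iff (by norm_num)]
    simpa using h
  unfold wassersteinDist at h2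
  simp only [iInf_lt_iff] at h2
  obtain ⟨γ, hγ, h3⟩ := h2
  refine ⟨γ, hγ, ?_⟩
  rw [ENNReal.rpow_lt_rpow_iff (by norm_num)] at h3
  simpa using h3

theorem mem_wassersteinSpace_two {d : ℕ} {μ : Measure (EuclideanSpace ℝ (Fin d))} :
    μ ∈ WassersteinSpace d 2 ↔ IsProbabilityMeasure μ ∧ ∫⁻ x, ‖x‖ₑ ^ 2 ∂μ < ∞ := by
  simp [WassersteinSpace]

theorem enorm_sub_sq_le {F : Type*} [SeminormedAddCommGroup F] (x y : F) :
    ‖x - y‖ₑ ^ 2 ≤ 2 * ‖x‖ₑ ^ 2 + 2 * ‖y‖ₑ ^ 2 := by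
  have h : ‖x - y‖ ^ 2 ≤ 2 * ‖x‖ ^ 2 + 2 * ‖y‖ ^ 2 := by
    nlinarith [norm_sub_le x y, norm_nonneg (x - y), sq_nonneg (‖x‖ - ‖y‖)]
  simp only [← ofReal_norm]
  rw [← ENNReal.ofReal_pow (norm_nonneg _), ← ENNReal.ofReal_pow (norm_nonneg _),
    ← ENNReal.ofReal_pow (norm_nonneg _),
    show (2 : ℝ≥0∞) = ENNReal.ofReal 2 by simp, ← ENNReal.ofReal_mul (by norm_num),
    ← ENNReal.ofReal_mul (by norm_num), ← ENNReal.ofReal_add (by positivity) (by positivity)]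
  exact ENNReal.ofReal_le_ofReal h

theorem prod_mem_transportPlans {d : ℕ} (μ ν : Measure (EuclideanSpace ℝ (Fin d)))
    [IsProbabilityMeasure μ] [IsProbabilityMeasure ν] : μ.prod ν ∈ transportPlans μ ν :=
  ⟨inferInstance, by simp, by simp⟩

theorem wassersteinDist_two_lt_top {d : ℕ} {μ ν : Measure (EuclideanSpace ℝ (Fin d))}
    (hμ : μ ∈ WassersteinSpace d 2) (hν : ν ∈ WassersteinSpace d 2) :
    wassersteinDist 2 μ ν ^ 2 < ∞ := by
  obtain ⟨hμ1, hμ2⟩ := mem_wassersteinSpace_two.1 hμ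
  obtain ⟨hν1, hν2⟩ := mem_wassersteinSpace_two.1 hν
  refine (wassersteinDist_two_sq_le (prod_mem_transportPlans μ ν)).trans_lt ?_
  calc ∫⁻ z, ‖z.1 - z.2‖ₑ ^ 2 ∂(μ.prod ν)
      ≤ ∫⁻ z, (2 * ‖z.1‖ₑ ^ 2 + 2 * ‖z.2‖ₑ ^ 2) ∂(μ.prod ν) :=
        lintegral_mono fun z => enorm_sub_sq_le _ _
    _ = 2 * ∫⁻ x, ‖x‖ₑ ^ 2 ∂μ + 2 * ∫⁻ x, ‖x‖ₑ ^ 2 ∂ν := by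
      rw [lintegral_add_left (by fun_prop), lintegral_const_mul _ (by fun_prop),
        lintegral_const_mul _ (by fun_prop)]
      congr 2
      · rw [← lintegral_map (f := fun x : EuclideanSpace ℝ (Fin d) => ‖x‖ₑ ^ 2) (by fun_prop)
          measurable_fst]
        simp
      · rw [← lintegral_map (f := fun x : EuclideanSpace ℝ (Fin d) => ‖x‖ₑ ^ 2) (by fun_prop)
          measurable_snd]
        simp
    _ < ∞ := by finiteness

/-! ### Barycenters as laws of weighted averages. -/

/-- Bias–variance decomposition: expanding around the weighted mean, the cross term vanishes because
the weighted deviations sum to zero. -/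
theorem sum_mul_norm_sub_sq {F ι : Type*} [NormedAddCommGroup F] [InnerProductSpace ℝ F]
    (J : Finset ι) (lam : ι → ℝ) (hsum : ∑ j ∈ J, lam j = 1) (y : ι → F) (x : F) :
    ∑ j ∈ J, lam j * ‖y j - x‖ ^ 2 =
      ∑ j ∈ J, lam j * ‖y j - ∑ k ∈ J, lam k • y k‖ ^ 2 + ‖x - ∑ k ∈ J, lam k • y k‖ ^ 2 := by
  set z := ∑ k ∈ J, lam k • y k with hz
  have h1 : ∀ j, lam j * ‖y j - x‖ ^ 2 =
      lam j * ‖y j - z‖ ^ 2 - 2 * inner ℝ (lam j • (y j - z)) (x - z)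
        + lam j * ‖x - z‖ ^ 2 := by
    intro j
    have : y j - x = (y j - z) - (x - z) := by abel
    rw [this, norm_sub_sq_real, real_inner_smul_left]
    ring
  have h2 : ∑ j ∈ J, lam j • (y j - z) = 0 := by
    simp only [smul_sub, Finset.sum_sub_distrib, ← Finset.sum_smul, hsum, one_smul, ← hz, sub_self]
  simp only [h1, Finset.sum_add_distrib, Finset.sum_sub_distrib, ← Finset.mul_sum, ← sum_inner, h2,
    ← Finset.sum_mul, hsum]
  simp

theorem sum_mul_enorm_sub_sq {F ι : Type*} [NormedAddCommGroup F] [InnerProductSpace ℝ F]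
    (J : Finset ι) (lam : ι → ℝ) (hlam : ∀ j ∈ J, 0 ≤ lam j) (hsum : ∑ j ∈ J, lam j = 1)
    (y : ι → F) (x : F) :
    ∑ j ∈ J, ENNReal.ofReal (lam j) * ‖y j - x‖ₑ ^ 2 =
      ∑ j ∈ J, ENNReal.ofReal (lam j) * ‖y j - ∑ k ∈ J, lam k • y k‖ₑ ^ 2
        + ‖x - ∑ k ∈ J, lam k • y k‖ₑ ^ 2 := by
  have h : ∀ v : F, ∑ j ∈ J, ENNReal.ofReal (lam j) * ‖y j - v‖ₑ ^ 2 =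
      ENNReal.ofReal (∑ j ∈ J, lam j * ‖y j - v‖ ^ 2) := by
    intro v
    rw [ENNReal.ofReal_sum_of_nonneg fun j hj => mul_nonneg (hlam j hj) (sq_nonneg _)]
    refine Finset.sum_congr rfl fun j hj => ?_
    rw [ENNReal.ofReal_mul (hlam j hj), ENNReal.ofReal_pow (norm_nonneg _), ofReal_norm]
  rw [h, h, sum_mul_norm_sub_sq J lam hsum y x, ENNReal.ofReal_add
    (Finset.sum_nonneg fun j hj => mul_nonneg (hlam j hj) (sq_nonneg _)) (sq_nonneg _),
    ENNReal.ofReal_pow (norm_nonneg _), ofReal_norm]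

theorem enorm_sum_smul_sq_le {F ι : Type*} [NormedAddCommGroup F] [InnerProductSpace ℝ F]
    (J : Finset ι) (lam : ι → ℝ) (hlam : ∀ j ∈ J, 0 ≤ lam j) (hsum : ∑ j ∈ J, lam j = 1)
    (y : ι → F) :
    ‖∑ k ∈ J, lam k • y k‖ₑ ^ 2 ≤ ∑ j ∈ J, ENNReal.ofReal (lam j) * ‖y j‖ₑ ^ 2 := by
  have h := sum_mul_enorm_sub_sq J lam hlam hsum y 0
  simp only [sub_zero, zero_sub, enorm_neg] at h
  rw [h]
  exact le_add_self

/-- A barycenter is, up to an arbitrarily small error in `L²`, the average of random variables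
with the given laws. -/
theorem exists_coupling_of_mem_barycenters {d : ℕ} {ι : Type} [Fintype ι] {J : Finset ι}
    {m : ι → Measure (EuclideanSpace ℝ (Fin d))} {lam : ι → ℝ}
    {ν : Measure (EuclideanSpace ℝ (Fin d))} (hν : ν ∈ barycenters J m lam)
    (hm : ∀ j, m j ∈ WassersteinSpace d 2) (hlam : ∀ j ∈ J, 0 ≤ lam j)
    (hsum : ∑ j ∈ J, lam j = 1) {ε : ℝ} (hε : 0 < ε) :
    ∃ (Ω : Type) (_ : MeasurableSpace Ω) (P : Measure Ω) (X : Ω → EuclideanSpace ℝ (Fin d))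
      (Y : ι → Ω → EuclideanSpace ℝ (Fin d)),
      IsProbabilityMeasure P ∧ Measurable X ∧ (∀ j, Measurable (Y j)) ∧ P.map X = ν ∧
        (∀ j, P.map (Y j) = m j) ∧
        ∫⁻ ω, ‖X ω - ∑ j ∈ J, lam j • Y j ω‖ₑ ^ 2 ∂P ≤ ENNReal.ofReal ε := by
  obtain ⟨hν2, hmin⟩ := hν
  have hνp : IsProbabilityMeasure ν := (mem_wassersteinSpace_two.1 hν2).1
  have hfin : ∀ j, wassersteinDist 2 (m j) ν ^ 2 < ∞ := fun j =>
    wassersteinDist_two_lt_top (hm j) hν2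
  have hplan : ∀ j, ∃ γ ∈ transportPlans (m j) ν,
      ∫⁻ z, ‖z.1 - z.2‖ₑ ^ 2 ∂γ < wassersteinDist 2 (m j) ν ^ 2 + ENNReal.ofReal ε := fun j =>
    exists_transportPlan_lt (ENNReal.lt_add_right (hfin j).ne (by simpa using hε))
  choose γ hγ hcost using hplan
  have hγp : ∀ j, IsProbabilityMeasure (γ j) := fun j => (hγ j).1
  obtain ⟨Ω, _, P, X, Y, hP, hX, hY, hlaw⟩ := exists_gluing ν γ fun j => (hγ j).2.2
  have hne : Nonempty ι := by
    by_contra h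
    rw [not_nonempty_iff] at h
    rw [Finset.eq_empty_of_isEmpty J] at hsum
    simp at hsum
  have hXν : P.map X = ν := by
    obtain ⟨j⟩ := hne
    rw [← (hγ j).2.2, ← hlaw j, Measure.map_map measurable_snd ((hY j).prodMk hX)]
    rfl
  have hYm : ∀ j, P.map (Y j) = m j := by
    intro j
    rw [← (hγ j).2.1, ← hlaw j, Measure.map_map measurable_fst ((hY j).prodMk hX)]
    rfl
  refine ⟨Ω, _, P, X, Y, hP, hX, hY, hXν, hYm, ?_⟩
  set Z : Ω → EuclideanSpace ℝ (Fin d) := fun ω => ∑ j ∈ J, lam j • Y j ω with hZdef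
  have hZ : Measurable Z := Finset.measurable_sum _ fun j _ => by have := hY j; fun_prop
  have hZmem : P.map Z ∈ WassersteinSpace d 2 := by
    refine mem_wassersteinSpace_two.2 ⟨Measure.isProbabilityMeasure_map hZ.aemeasurable, ?_⟩
    rw [lintegral_map (by fun_prop) hZ]
    calc ∫⁻ ω, ‖Z ω‖ₑ ^ 2 ∂P
        ≤ ∫⁻ ω, ∑ j ∈ J, ENNReal.ofReal (lam j) * ‖Y j ω‖ₑ ^ 2 ∂P :=
          lintegral_mono fun ω => enorm_sum_smul_sq_le J lam hlam hsum fun j => Y j ω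
      _ = ∑ j ∈ J, ENNReal.ofReal (lam j) * ∫⁻ x, ‖x‖ₑ ^ 2 ∂(m j) := by
        rw [lintegral_finsetSum _ fun j _ => by have := hY j; fun_prop]
        refine Finset.sum_congr rfl fun j _ => ?_
        have := hY j
        rw [lintegral_const_mul _ (by fun_prop), ← hYm j, lintegral_map (by fun_prop) (hY j)]
      _ < ∞ := ENNReal.sum_lt_top.2 fun j _ =>
        ENNReal.mul_lt_top ENNReal.ofReal_lt_top (mem_wassersteinSpace_two.1 (hm j)).2
  have hZcost : barycenterCost J m lam (P.map Z) ≤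
      ∑ j ∈ J, ENNReal.ofReal (lam j) * ∫⁻ ω, ‖Y j ω - Z ω‖ₑ ^ 2 ∂P := by
    refine Finset.sum_le_sum fun j _ => ?_
    gcongr
    have hYZ : Measurable fun ω => (Y j ω, Z ω) := (hY j).prodMk hZ
    have hpl : P.map (fun ω => (Y j ω, Z ω)) ∈ transportPlans (m j) (P.map Z) := by
      refine ⟨Measure.isProbabilityMeasure_map hYZ.aemeasurable, ?_, ?_⟩
      · rw [Measure.map_map measurable_fst hYZ, ← hYm j]; rfl
      · rw [Measure.map_map measurable_snd hYZ]; rfl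
    refine (wassersteinDist_two_sq_le hpl).trans_eq ?_
    rw [lintegral_map (by fun_prop) hYZ]
  -- Replacing `X` by the average `Z` lowers the cost of the coupling by exactly `E‖X - Z‖²`. Since
  -- `ν` is a minimizer and the plans are within `ε` of optimal, that gain is at most `ε`.
  have hident : ∑ j ∈ J, ENNReal.ofReal (lam j) * ∫⁻ ω, ‖Y j ω - X ω‖ₑ ^ 2 ∂P =
      ∑ j ∈ J, ENNReal.ofReal (lam j) * ∫⁻ ω, ‖Y j ω - Z ω‖ₑ ^ 2 ∂P
        + ∫⁻ ω, ‖X ω - Z ω‖ₑ ^ 2 ∂P := by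
    have hs : ∀ V : Ω → EuclideanSpace ℝ (Fin d), Measurable V →
        ∑ j ∈ J, ENNReal.ofReal (lam j) * ∫⁻ ω, ‖Y j ω - V ω‖ₑ ^ 2 ∂P =
          ∫⁻ ω, ∑ j ∈ J, ENNReal.ofReal (lam j) * ‖Y j ω - V ω‖ₑ ^ 2 ∂P := by
      intro V hV
      rw [lintegral_finsetSum _ fun j _ => by have := hY j; fun_prop]
      refine Finset.sum_congr rfl fun j _ => ?_
      have := hY j
      rw [lintegral_const_mul _ (by fun_prop)]
    rw [hs X hX, hs Z hZ, ← lintegral_add_right _ (by fun_prop)]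
    exact lintegral_congr fun ω => sum_mul_enorm_sub_sq J lam hlam hsum (fun j => Y j ω) (X ω)
  have hXcost : ∑ j ∈ J, ENNReal.ofReal (lam j) * ∫⁻ ω, ‖Y j ω - X ω‖ₑ ^ 2 ∂P ≤
      barycenterCost J m lam ν + ENNReal.ofReal ε := by
    have hone : ENNReal.ofReal ε = ∑ j ∈ J, ENNReal.ofReal (lam j) * ENNReal.ofReal ε := by
      rw [← Finset.sum_mul, ← ENNReal.ofReal_sum_of_nonneg hlam, hsum]; simp
    rw [hone, barycenterCost, ← Finset.sum_add_distrib]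
    refine Finset.sum_le_sum fun j _ => ?_
    rw [← mul_add]
    gcongr
    refine le_trans (le_of_eq ?_) (hcost j).le
    rw [← hlaw j, lintegral_map (by fun_prop) ((hY j).prodMk hX)]
  have hcostfin : barycenterCost J m lam ν ≠ ∞ :=
    (ENNReal.sum_lt_top.2 fun j _ => ENNReal.mul_lt_top ENNReal.ofReal_lt_top (hfin j)).ne
  refine (ENNReal.add_le_add_iff_left hcostfin).1 ?_
  calc barycenterCost J m lam ν + ∫⁻ ω, ‖X ω - Z ω‖ₑ ^ 2 ∂P
      ≤ ∑ j ∈ J, ENNReal.ofReal (lam j) * ∫⁻ ω, ‖Y j ω - Z ω‖ₑ ^ 2 ∂P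
        + ∫⁻ ω, ‖X ω - Z ω‖ₑ ^ 2 ∂P := by
        gcongr
        exact (hmin hZmem).trans hZcost
    _ = ∑ j ∈ J, ENNReal.ofReal (lam j) * ∫⁻ ω, ‖Y j ω - X ω‖ₑ ^ 2 ∂P := hident.symm
    _ ≤ _ := hXcost

/-! ### Convex test functions and Jensen's inequality. -/

/-- Nonnegative convex functions whose increments are controlled by a linearly growing modulus, so
that they are integrable against, and vary continuously with, measures of finite second moment. -/
structure QuadraticConvex {F : Type*} [NormedAddCommGroup F] [NormedSpace ℝ F] (f : F → ℝ) :
    Prop where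
  convex : ConvexOn ℝ Set.univ f
  continuous : Continuous f
  nonneg : ∀ x, 0 ≤ f x
  exists_le : ∃ C, 0 ≤ C ∧ ∀ x y, f x ≤ f y + C * (‖x - y‖ * (1 + ‖x‖ + ‖y‖))

theorem integrable_norm_sq {d : ℕ} {μ : Measure (EuclideanSpace ℝ (Fin d))}
    (hμ : μ ∈ WassersteinSpace d 2) : Integrable (fun x => ‖x‖ ^ 2) μ := by
  refine ⟨by fun_prop, ?_⟩
  rw [hasFiniteIntegral_iff_enorm]
  simpa using (mem_wassersteinSpace_two.1 hμ).2

theorem QuadraticConvex.integrable {d : ℕ} {f : EuclideanSpace ℝ (Fin d) → ℝ}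
    (hf : QuadraticConvex f) {μ : Measure (EuclideanSpace ℝ (Fin d))}
    (hμ : μ ∈ WassersteinSpace d 2) : Integrable f μ := by
  have hp : IsProbabilityMeasure μ := (mem_wassersteinSpace_two.1 hμ).1
  obtain ⟨C, hC, hfC⟩ := hf.exists_le
  have hint : Integrable (fun x => f 0 + C * (1 + 2 * ‖x‖ ^ 2)) μ :=
    (integrable_const _).add
      (((integrable_const _).add ((integrable_norm_sq hμ).const_mul 2)).const_mul C)
  refine hint.mono' hf.continuous.aestronglyMeasurable (Eventually.of_forall fun x => ?_)
  rw [Real.norm_of_nonneg (hf.nonneg x)]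
  have h := hfC x 0
  simp only [sub_zero, norm_zero, add_zero] at h
  have h2 : ‖x‖ * (1 + ‖x‖) ≤ 1 + 2 * ‖x‖ ^ 2 := by nlinarith [sq_nonneg (‖x‖ - 1)]
  have := mul_le_mul_of_nonneg_left h2 hC
  linarith

/-- **Jensen's inequality for Wasserstein barycenters.** -/
theorem QuadraticConvex.integral_barycenter_le {d : ℕ} {ι : Type} [Fintype ι] {J : Finset ι}
    {m : ι → Measure (EuclideanSpace ℝ (Fin d))} {lam : ι → ℝ}
    {ν : Measure (EuclideanSpace ℝ (Fin d))} {f : EuclideanSpace ℝ (Fin d) → ℝ}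
    (hf : QuadraticConvex f) (hν : ν ∈ barycenters J m lam)
    (hm : ∀ j, m j ∈ WassersteinSpace d 2) (hlam : ∀ j ∈ J, 0 ≤ lam j)
    (hsum : ∑ j ∈ J, lam j = 1) :
    ∫ x, f x ∂ν ≤ ∑ j ∈ J, lam j * ∫ x, f x ∂(m j) := by
  obtain ⟨C, hC, hfC⟩ := hf.exists_le
  set A := ∑ j ∈ J, lam j * ∫ x, ‖x‖ ^ 2 ∂(m j) with hA
  set B := ∫ x, ‖x‖ ^ 2 ∂ν with hB
  have hA0 : 0 ≤ A := Finset.sum_nonneg fun j hj => mul_nonneg (hlam j hj)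
    (integral_nonneg fun x => sq_nonneg _)
  have hB0 : 0 ≤ B := integral_nonneg fun x => sq_nonneg _
  -- Jensen applies exactly to the average `Z`. Passing from `Z` to `X` costs `C‖X - Z‖(1 + ‖X‖ +
  -- ‖Z‖)`, which Young's inequality with parameter `η` splits; a coupling error `η²` balances the
  -- two halves at order `η`.
  have hbound : ∀ η : ℝ, 0 < η → ∫ x, f x ∂ν ≤
      ∑ j ∈ J, lam j * ∫ x, f x ∂(m j) + C * (η + 3 * η * (1 + B + A)) := by
    intro η hη
    obtain ⟨Ω, _, P, X, Y, hP, hX, hY, hXν, hYm, hXZ⟩ :=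
      exists_coupling_of_mem_barycenters hν hm hlam hsum (ε := η ^ 2) (by positivity)
    set Z : Ω → EuclideanSpace ℝ (Fin d) := fun ω => ∑ j ∈ J, lam j • Y j ω with hZ
    have hZm : Measurable Z := Finset.measurable_sum _ fun j _ => by have := hY j; fun_prop
    have hpt : ∀ ω, f (X ω) ≤ ∑ j ∈ J, lam j * f (Y j ω) + C * (‖X ω - Z ω‖ ^ 2 * η⁻¹
        + 3 * η * (1 + ‖X ω‖ ^ 2 + ∑ j ∈ J, lam j * ‖Y j ω‖ ^ 2)) := by
      intro ω
      have h1 : f (Z ω) ≤ ∑ j ∈ J, lam j * f (Y j ω) :=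
        hf.convex.map_sum_le hlam hsum fun _ _ => Set.mem_univ _
      have h2 : ‖Z ω‖ ^ 2 ≤ ∑ j ∈ J, lam j * ‖Y j ω‖ ^ 2 := by
        have := sum_mul_norm_sub_sq J lam hsum (fun j => Y j ω) 0
        simp only [sub_zero, zero_sub, norm_neg] at this
        rw [this]
        exact le_add_of_nonneg_left
          (Finset.sum_nonneg fun j hj => mul_nonneg (hlam j hj) (sq_nonneg _))
      have h3 : ‖X ω - Z ω‖ * (1 + ‖X ω‖ + ‖Z ω‖) ≤
          ‖X ω - Z ω‖ ^ 2 * η⁻¹ + η * (1 + ‖X ω‖ + ‖Z ω‖) ^ 2 := by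
        set p := ‖X ω - Z ω‖
        set r := 1 + ‖X ω‖ + ‖Z ω‖
        have hpr : 0 ≤ (p - η * r) ^ 2 * η⁻¹ := by positivity
        have hex : (p - η * r) ^ 2 * η⁻¹ = p ^ 2 * η⁻¹ - 2 * (p * r) + η * r ^ 2 := by
          field_simp; ring
        have hpr0 : 0 ≤ p * r := by positivity
        linarith
      have h4 : (1 + ‖X ω‖ + ‖Z ω‖) ^ 2 ≤ 3 * (1 + ‖X ω‖ ^ 2 + ‖Z ω‖ ^ 2) := by
        nlinarith [sq_nonneg (1 - ‖X ω‖), sq_nonneg (1 - ‖Z ω‖), sq_nonneg (‖X ω‖ - ‖Z ω‖)]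
      have h5 : η * (1 + ‖X ω‖ + ‖Z ω‖) ^ 2 ≤
          3 * η * (1 + ‖X ω‖ ^ 2 + ∑ j ∈ J, lam j * ‖Y j ω‖ ^ 2) := by
        have := mul_le_mul_of_nonneg_left
          (h4.trans (mul_le_mul_of_nonneg_left (add_le_add_right h2 _) (by norm_num))) hη.le
        linarith
      have h6 := mul_le_mul_of_nonneg_left (h3.trans (add_le_add_right h5 _)) hC
      linarith [hfC (X ω) (Z ω)]
    have iX2 : Integrable (fun ω => ‖X ω‖ ^ 2) P :=
      (hXν ▸ integrable_norm_sq hν.1 : Integrable (fun x => ‖x‖ ^ 2) (P.map X)).comp_measurable hX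
    have iY2 : ∀ j, Integrable (fun ω => ‖Y j ω‖ ^ 2) P := fun j =>
      ((hYm j).symm ▸ integrable_norm_sq (hm j) :
        Integrable (fun x => ‖x‖ ^ 2) (P.map (Y j))).comp_measurable (hY j)
    have ifX : Integrable (fun ω => f (X ω)) P :=
      (hXν ▸ hf.integrable hν.1 : Integrable f (P.map X)).comp_measurable hX
    have ifY : ∀ j, Integrable (fun ω => f (Y j ω)) P := fun j =>
      ((hYm j).symm ▸ hf.integrable (hm j) : Integrable f (P.map (Y j))).comp_measurable (hY j)
    have hXZ' : ∫⁻ ω, ‖‖X ω - Z ω‖ ^ 2‖ₑ ∂P ≤ ENNReal.ofReal (η ^ 2) := by simpa using hXZ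
    have iXZ : Integrable (fun ω => ‖X ω - Z ω‖ ^ 2) P :=
      ⟨by fun_prop, (hasFiniteIntegral_iff_enorm).2 (hXZ'.trans_lt ENNReal.ofReal_lt_top)⟩
    have hXZint : ∫ ω, ‖X ω - Z ω‖ ^ 2 ∂P ≤ η ^ 2 := by
      rw [integral_eq_lintegral_of_nonneg_ae (Eventually.of_forall fun ω => sq_nonneg _) (by fun_prop)]
      refine ENNReal.toReal_le_of_le_ofReal (by positivity) (le_trans (le_of_eq ?_) hXZ)
      refine lintegral_congr fun ω => ?_
      rw [ENNReal.ofReal_pow (norm_nonneg _), ofReal_norm]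
    have iS1 : Integrable (fun ω => ∑ j ∈ J, lam j * f (Y j ω)) P :=
      integrable_finsetSum _ fun j _ => (ifY j).const_mul _
    have iS2 : Integrable (fun ω => ∑ j ∈ J, lam j * ‖Y j ω‖ ^ 2) P :=
      integrable_finsetSum _ fun j _ => (iY2 j).const_mul _
    have i0 : Integrable (fun ω => 1 + ‖X ω‖ ^ 2) P := (integrable_const _).add iX2
    have i1 : Integrable (fun ω => 1 + ‖X ω‖ ^ 2 + ∑ j ∈ J, lam j * ‖Y j ω‖ ^ 2) P :=
      i0.add iS2
    have i2 : Integrable (fun ω => ‖X ω - Z ω‖ ^ 2 * η⁻¹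
        + 3 * η * (1 + ‖X ω‖ ^ 2 + ∑ j ∈ J, lam j * ‖Y j ω‖ ^ 2)) P :=
      (iXZ.mul_const _).add (i1.const_mul _)
    have hA' : ∫ ω, ∑ j ∈ J, lam j * ‖Y j ω‖ ^ 2 ∂P = A := by
      rw [integral_finsetSum _ fun j _ => (iY2 j).const_mul _]
      refine Finset.sum_congr rfl fun j _ => ?_
      rw [integral_const_mul, ← hYm j, integral_map (hY j).aemeasurable (by fun_prop)]
    have hB' : ∫ ω, ‖X ω‖ ^ 2 ∂P = B := by
      rw [hB, ← hXν, integral_map hX.aemeasurable (by fun_prop)]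
    have hF : ∫ ω, ∑ j ∈ J, lam j * f (Y j ω) ∂P = ∑ j ∈ J, lam j * ∫ x, f x ∂(m j) := by
      rw [integral_finsetSum _ fun j _ => (ifY j).const_mul _]
      refine Finset.sum_congr rfl fun j _ => ?_
      rw [integral_const_mul, ← hYm j,
        integral_map (hY j).aemeasurable hf.continuous.aestronglyMeasurable]
    calc ∫ x, f x ∂ν = ∫ ω, f (X ω) ∂P := by
          rw [← hXν, integral_map hX.aemeasurable hf.continuous.aestronglyMeasurable]
      _ ≤ ∫ ω, (∑ j ∈ J, lam j * f (Y j ω) + C * (‖X ω - Z ω‖ ^ 2 * η⁻¹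
            + 3 * η * (1 + ‖X ω‖ ^ 2 + ∑ j ∈ J, lam j * ‖Y j ω‖ ^ 2))) ∂P :=
          integral_mono ifX (iS1.add (i2.const_mul C)) hpt
      _ = ∑ j ∈ J, lam j * ∫ x, f x ∂(m j)
          + C * ((∫ ω, ‖X ω - Z ω‖ ^ 2 ∂P) * η⁻¹ + 3 * η * (1 + B + A)) := by
          rw [integral_add iS1 (i2.const_mul C), integral_const_mul,
            integral_add (iXZ.mul_const _) (i1.const_mul _), integral_mul_const,
            integral_const_mul, integral_add i0 iS2,
            integral_add (integrable_const _) iX2, hA', hB', hF]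
          simp
      _ ≤ _ := by
          have : (∫ ω, ‖X ω - Z ω‖ ^ 2 ∂P) * η⁻¹ ≤ η := by
            rw [← div_eq_mul_inv, div_le_iff₀ hη]; nlinarith
          gcongr
  refine le_of_forall_pos_le_add fun e he => ?_
  -- `K` may vanish, hence the divisor `K + 1` in the choice of `η`.
  set K := C * (1 + 3 * (1 + B + A)) with hK
  have hK0 : 0 ≤ K := by positivity
  refine (hbound (e / (K + 1)) (by positivity)).trans (add_le_add_right ?_ _)
  have : C * (e / (K + 1) + 3 * (e / (K + 1)) * (1 + B + A)) = K * (e / (K + 1)) := by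
    rw [hK]; ring
  rw [this, mul_div_assoc', div_le_iff₀ (by positivity)]
  nlinarith

/-! ### Consensus over jointly connected graphs. -/

/-- A proper nonempty set of vertices of a connected graph is crossed by an edge. -/
theorem SimpleGraph.Connected.exists_adj_crossing {V : Type*} {G : SimpleGraph V}
    (hG : G.Connected) {S : Set V} (hS : S.Nonempty) (hS' : S ≠ Set.univ) :
    ∃ a ∈ S, ∃ b ∉ S, G.Adj a b := by
  by_contra! h
  obtain ⟨a, ha⟩ := hS
  refine hS' (Set.eq_univ_of_forall fun b => ?_)
  obtain ⟨p⟩ := hG.preconnected a b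
  induction p with
  | nil => exact ha
  | cons hadj _ ih => exact ih (by_contra fun hb => h _ ha _ hb hadj)

theorem mem_neighbors {n : ℕ} {E : Set (Fin n × Fin n)} {i j : Fin n} :
    j ∈ neighbors E i ↔ (i, j) ∈ E := by
  simp [neighbors]

/-- Consensus for subsolutions of time-varying averaging over jointly connected graphs. -/
theorem tendsto_of_le_weighted_sum {n : ℕ} (hn : 0 < n)
    (E : ℕ → Set (Fin n × Fin n))
    (hE_symm : ∀ t i j, (i, j) ∈ E t → (j, i) ∈ E t)
    (hE_self : ∀ t i, (i, i) ∈ E t)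
    (w : ℕ → Matrix (Fin n) (Fin n) ℝ)
    (hw_sum : ∀ t i, ∑ j ∈ neighbors (E t) i, w t i j = 1)
    (δ : ℝ) (hδ : δ ∈ Set.Ioo (0 : ℝ) 1)
    (hw_lower : ∀ t i, ∀ j ∈ neighbors (E t) i, δ ≤ w t i j)
    (τ : ℕ → ℕ) (hτ_zero : τ 0 = 0) (hτ_mono : StrictMono τ)
    (L : ℕ) (hτ_bdd : ∀ k, τ (k + 1) - τ k ≤ L)
    (h_conn : ∀ k, JointlyConnected E (Set.Ico (τ k) (τ (k + 1))))
    (V : ℕ → Fin n → ℝ) (hV : ∀ t i, 0 ≤ V t i)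
    (hVstep : ∀ t i, V (t + 1) i ≤ ∑ j ∈ neighbors (E t) i, w t i j * V t j) :
    (∀ t i c, (∀ j, V 0 j ≤ c) → V t i ≤ c) ∧ ∃ M, ∀ i, Tendsto (fun t => V t i) atTop (𝓝 M) := by
  have hne : Nonempty (Fin n) := ⟨⟨0, hn⟩⟩
  have hwnn : ∀ t i, ∀ j ∈ neighbors (E t) i, 0 ≤ w t i j := fun t i j hj =>
    hδ.1.le.trans (hw_lower t i j hj)
  have hstep : ∀ t c, (∀ j, V t j ≤ c) → ∀ j, V (t + 1) j ≤ c := by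
    intro t c hc i
    calc V (t + 1) i ≤ ∑ j ∈ neighbors (E t) i, w t i j * V t j := hVstep t i
      _ ≤ ∑ j ∈ neighbors (E t) i, w t i j * c :=
        Finset.sum_le_sum fun j hj => mul_le_mul_of_nonneg_left (hc j) (hwnn t i j hj)
      _ = c := by rw [← Finset.sum_mul, hw_sum, one_mul]
  have hsteps : ∀ t c, (∀ j, V t j ≤ c) → ∀ s, ∀ j, V (t + s) j ≤ c := by
    intro t c hc s
    induction s with
    | zero => exact hc
    | succ s ih => exact hstep _ _ ih
  refine ⟨fun t i c hc => by simpa using hsteps 0 c hc t i, ?_⟩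
  set M : ℕ → ℝ := fun t => Finset.univ.sup' Finset.univ_nonempty (V t) with hMdef
  have hVM : ∀ t j, V t j ≤ M t := fun t j => Finset.le_sup' (V t) (Finset.mem_univ j)
  have hMle : ∀ t c, (∀ j, V t j ≤ c) → M t ≤ c := fun t c hc => Finset.sup'_le _ _ fun j _ => hc j
  have hManti : Antitone M := antitone_nat_of_succ_le fun t => hMle _ _ (hstep t _ (hVM t))
  have hMnn : ∀ t, 0 ≤ M t := fun t => (hV t ⟨0, hn⟩).trans (hVM t _)
  have hMlim : Tendsto M atTop (𝓝 (⨅ t, M t)) :=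
    tendsto_atTop_ciInf hManti ⟨0, by rintro _ ⟨t, rfl⟩; exact hMnn t⟩
  -- A deficit `a` below the ceiling `c` at `l` passes to each neighbour in one step, shrunk at
  -- worst by the minimal weight `δ`.
  have hpropagate : ∀ t c a, 0 ≤ a → (∀ j, V t j ≤ c) → ∀ i l, (i, l) ∈ E t → V t l ≤ c - a →
      V (t + 1) i ≤ c - δ * a := by
    intro t c a ha hc i l hil hl
    have hl' : l ∈ neighbors (E t) i := mem_neighbors.2 hil
    calc V (t + 1) i ≤ ∑ j ∈ neighbors (E t) i, w t i j * V t j := hVstep t i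
      _ ≤ ∑ j ∈ neighbors (E t) i, (w t i j * c - if j = l then w t i l * a else 0) := by
        refine Finset.sum_le_sum fun j hj => ?_
        split_ifs with h
        · subst h
          nlinarith [hwnn t i j hj]
        · simpa using mul_le_mul_of_nonneg_left (hc j) (hwnn t i j hj)
      _ = c - w t i l * a := by
        rw [Finset.sum_sub_distrib, ← Finset.sum_mul, hw_sum, one_mul, Finset.sum_ite_eq', if_pos hl']
      _ ≤ c - δ * a := by
        have := mul_le_mul_of_nonneg_right (hw_lower t i l hl') ha
        linarith
  -- the set of agents already influenced, starting from agent `j` at time `t₀`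
  have hkey : ∀ t₀ j, ∃ T, T ≤ (n + 1) * L ∧ ∀ i, V (t₀ + T) i ≤ M t₀ - δ ^ T * (M t₀ - V t₀ j) := by
    intro t₀ j
    set a := M t₀ - V t₀ j with ha
    have ha0 : 0 ≤ a := sub_nonneg.2 (hVM t₀ j)
    set S : ℕ → Set (Fin n) := fun s => {i | V (t₀ + s) i ≤ M t₀ - δ ^ s * a} with hS
    have hspread : ∀ s i l, (i, l) ∈ E (t₀ + s) → l ∈ S s → i ∈ S (s + 1) := by
      intro s i l hil hl
      have := hpropagate (t₀ + s) (M t₀) (δ ^ s * a) (mul_nonneg (pow_nonneg hδ.1.le _) ha0)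
        (hsteps t₀ _ (hVM t₀) s) i l hil hl
      change V (t₀ + (s + 1)) i ≤ M t₀ - δ ^ (s + 1) * a
      rw [pow_succ', mul_assoc]
      exact this
    have hSmono : Monotone S := monotone_nat_of_le_succ fun s i hi =>
      hspread s i i (hE_self _ i) hi
    have hj0 : j ∈ S 0 := by
      change V (t₀ + 0) j ≤ M t₀ - δ ^ 0 * a
      simp [ha]
    -- The first window starting at or after `t₀` begins within `L` steps; `τ 0 = 0` covers the case
    -- where it is the initial one.
    have hk0 : ∃ k, t₀ ≤ τ k ∧ τ k ≤ t₀ + L := by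
      have hex : ∃ k, t₀ ≤ τ k := ⟨t₀, hτ_mono.id_le t₀⟩
      classical
      refine ⟨Nat.find hex, Nat.find_spec hex, ?_⟩
      rcases hk : Nat.find hex with _ | k
      · omega
      · have h1 : ¬ t₀ ≤ τ k := Nat.find_min hex (by omega)
        have h2 := hτ_bdd k
        omega
    obtain ⟨k₀, hk₀, hk₀'⟩ := hk0
    -- Self-links keep influenced agents influenced, and joint connectivity supplies in each window
    -- an edge leaving the influenced set. Each window thus adds an agent until none is left, so `n`
    -- windows suffice.
    have hcard : ∀ r, S (τ (k₀ + r) - t₀) = Set.univ ∨ r + 1 ≤ (S (τ (k₀ + r) - t₀)).ncard := by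
      intro r
      induction r with
      | zero =>
        right
        have : j ∈ S (τ (k₀ + 0) - t₀) := hSmono (Nat.zero_le _) hj0
        have := (Set.ncard_pos (Set.toFinite _)).2 ⟨j, this⟩
        omega
      | succ r ih =>
        have hle : τ (k₀ + r) ≤ τ (k₀ + r + 1) := (hτ_mono (Nat.lt_succ_self _)).le
        have hle0 : t₀ ≤ τ (k₀ + r) := hk₀.trans (hτ_mono.monotone (by omega))
        have hsub : S (τ (k₀ + r) - t₀) ⊆ S (τ (k₀ + (r + 1)) - t₀) :=
          hSmono (Nat.sub_le_sub_right hle _)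
        by_cases huniv : S (τ (k₀ + r) - t₀) = Set.univ
        · left
          exact Set.eq_univ_of_univ_subset (huniv ▸ hsub)
        · right
          have ih' := ih.resolve_left huniv
          have hnonempty : (S (τ (k₀ + r) - t₀)).Nonempty := ⟨j, hSmono (Nat.zero_le _) hj0⟩
          obtain ⟨p, hp, q, hq, hadj⟩ :=
            (h_conn (k₀ + r)).exists_adj_crossing hnonempty huniv
          have hedge : ∃ s ∈ Set.Ico (τ (k₀ + r)) (τ (k₀ + r + 1)), (q, p) ∈ E s := by
            rw [SimpleGraph.fromRel_adj] at hadj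
            simp only [Set.mem_iUnion, exists_prop] at hadj
            rcases hadj.2 with ⟨s, hs, h⟩ | ⟨s, hs, h⟩
            · exact ⟨s, hs, hE_symm _ _ _ h⟩
            · exact ⟨s, hs, h⟩
          obtain ⟨s, hs, hqp⟩ := hedge
          have hts : t₀ ≤ s := hle0.trans hs.1
          have hqS : q ∈ S (s - t₀ + 1) := by
            refine hspread _ q p ?_ (hSmono (Nat.sub_le_sub_right hs.1 _) hp)
            rwa [Nat.add_sub_cancel' hts]
          have hqS' : q ∈ S (τ (k₀ + (r + 1)) - t₀) := by
            refine hSmono ?_ hqS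
            have := hs.2
            change s - t₀ + 1 ≤ τ (k₀ + r + 1) - t₀
            omega
          have := Set.ncard_lt_ncard (⟨hsub, fun h => hq (h hqS')⟩ :
            S (τ (k₀ + r) - t₀) ⊂ S (τ (k₀ + (r + 1)) - t₀)) (Set.toFinite _)
          omega
    have huniv : S (τ (k₀ + n) - t₀) = Set.univ := by
      rcases hcard n with h | h
      · exact h
      · have := Set.ncard_le_card (S (τ (k₀ + n) - t₀))
        simp only [Nat.card_eq_fintype_card, Fintype.card_fin] at this
        omega
    have hτr : ∀ r, τ (k₀ + r) ≤ τ k₀ + r * L := by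
      intro r
      induction r with
      | zero => simp
      | succ r ih =>
        have := hτ_bdd (k₀ + r)
        change τ (k₀ + r + 1) ≤ _
        rw [Nat.succ_mul]
        omega
    refine ⟨τ (k₀ + n) - t₀, ?_, fun i => ?_⟩
    · have := hτr n
      rw [Nat.succ_mul]
      omega
    · have hi : i ∈ S (τ (k₀ + n) - t₀) := huniv ▸ Set.mem_univ i
      exact hi
  set B := (n + 1) * L with hB
  have hδB : 0 < δ ^ B := pow_pos hδ.1 _
  -- The spread at time `t` is at most `δ ^ (-B)` times the drop of the maximum over the next `B`
  -- steps. That drop tends to zero because the maximum converges.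
  have hlower : ∀ t j, M t - (M t - M (t + B)) / δ ^ B ≤ V t j := by
    intro t j
    obtain ⟨T, hT, hTV⟩ := hkey t j
    have h1 : M (t + B) ≤ M t - δ ^ T * (M t - V t j) :=
      (hManti (by omega)).trans (hMle _ _ hTV)
    have h2 : δ ^ B * (M t - V t j) ≤ δ ^ T * (M t - V t j) :=
      mul_le_mul_of_nonneg_right (pow_le_pow_of_le_one hδ.1.le hδ.2.le hT) (sub_nonneg.2 (hVM t j))
    have h3 : M t - V t j ≤ (M t - M (t + B)) / δ ^ B := by
      rw [le_div_iff₀ hδB]; linarith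
    linarith
  refine ⟨⨅ t, M t, fun i => tendsto_of_tendsto_of_tendsto_of_le_of_le ?_ hMlim
    (fun t => hlower t i) (fun t => hVM t i)⟩
  have h := hMlim.sub (((hMlim.sub ((tendsto_add_atTop_iff_nat B).2 hMlim))).div_const (δ ^ B))
  simpa using h

/-! ### Test functions for characteristic functions and for tails. -/

theorem QuadraticConvex.comp_inner {F : Type*} [NormedAddCommGroup F] [InnerProductSpace ℝ F]
    {g : ℝ → ℝ} (hg : QuadraticConvex g) (u : F) :
    QuadraticConvex fun x : F => g (inner ℝ x u) := by
  obtain ⟨K, hK, hgK⟩ := hg.exists_le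
  have hlin : ∀ x : F, innerSL ℝ u x = inner ℝ x u := fun x => by
    rw [innerSL_apply_apply, real_inner_comm]
  refine ⟨?_, hg.continuous.comp (by fun_prop), fun x => hg.nonneg _,
    K * (‖u‖ * (1 + ‖u‖)), by positivity, fun x y => ?_⟩
  · have := hg.convex.comp_linearMap (innerSL ℝ u : F →ₗ[ℝ] ℝ)
    simp only [Set.preimage_univ] at this
    convert! this using 2 with x
    exact congrArg g (hlin x).symm
  · refine (hgK (inner ℝ x u) (inner ℝ y u)).trans (add_le_add_right ?_ _)
    rw [mul_assoc]
    refine mul_le_mul_of_nonneg_left ?_ hK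
    have h1 : ‖inner ℝ x u - inner ℝ y u‖ ≤ ‖u‖ * ‖x - y‖ := by
      rw [← inner_sub_left, mul_comm]; exact norm_inner_le_norm _ _
    have h2 : ‖inner ℝ x u‖ ≤ ‖x‖ * ‖u‖ := norm_inner_le_norm (𝕜 := ℝ) _ _
    have h3 : ‖inner ℝ y u‖ ≤ ‖y‖ * ‖u‖ := norm_inner_le_norm (𝕜 := ℝ) _ _
    have h4 : 1 + ‖inner ℝ x u‖ + ‖inner ℝ y u‖ ≤ (1 + ‖u‖) * (1 + ‖x‖ + ‖y‖) := by
      nlinarith [norm_nonneg x, norm_nonneg y, norm_nonneg u]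
    calc _ ≤ (‖u‖ * ‖x - y‖) * ((1 + ‖u‖) * (1 + ‖x‖ + ‖y‖)) := by gcongr
      _ = _ := by ring

theorem quadraticConvex_half_sq : QuadraticConvex fun s : ℝ => s ^ 2 / 2 := by
  refine ⟨?_, by fun_prop, fun s => by positivity, 1, zero_le_one, fun x y => ?_⟩
  · have := (even_two.convexOn_pow (𝕜 := ℝ)).smul (c := (1 / 2 : ℝ)) (by norm_num)
    convert! this using 2 with x
    simp; ring
  · have h1 : (x - y) * (x + y) ≤ |x - y| * (|x| + |y|) :=
      (le_abs_self _).trans (by rw [abs_mul]; gcongr; exact abs_add_le _ _)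
    simp only [Real.norm_eq_abs]
    nlinarith [abs_nonneg (x - y), abs_nonneg x, abs_nonneg y,
      mul_nonneg (abs_nonneg (x - y)) (add_nonneg (abs_nonneg x) (abs_nonneg y))]

/-- The second derivative is `1 - cos (s + θ) ≥ 0`. Subtracting `s ^ 2 / 2`, itself a test function,
recovers the cosine up to a constant. -/
theorem quadraticConvex_cos (θ : ℝ) :
    QuadraticConvex fun s : ℝ => 1 + Real.cos (s + θ) + s ^ 2 / 2 := by
  have hd : ∀ s : ℝ, HasDerivAt (fun s : ℝ => 1 + Real.cos (s + θ) + s ^ 2 / 2)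
      (-Real.sin (s + θ) + s) s := by
    intro s
    have h1 : HasDerivAt (fun s : ℝ => Real.cos (s + θ)) (-Real.sin (s + θ) * 1) s :=
      ((hasDerivAt_id' s).add_const θ).cos
    have h2 : HasDerivAt (fun s : ℝ => s ^ 2 / 2) (2 * s / 2) s := by
      simpa using ((hasDerivAt_pow 2 s).div_const 2)
    exact ((h1.const_add 1).fun_add h2).congr_deriv (by ring)
  refine ⟨?_, by fun_prop, fun s => ?_, 2, zero_le_two, fun x y => ?_⟩
  · have hderiv : deriv (fun s : ℝ => 1 + Real.cos (s + θ) + s ^ 2 / 2) =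
        fun s => -Real.sin (s + θ) + s := funext fun s => (hd s).deriv
    refine Monotone.convexOn_univ_of_deriv (fun s => (hd s).differentiableAt) ?_
    rw [hderiv]
    have hd2 : ∀ s : ℝ, HasDerivAt (fun s : ℝ => -Real.sin (s + θ) + s)
        (-(Real.cos (s + θ) * 1) + 1) s := fun s =>
      ((hasDerivAt_id' s).add_const θ).sin.fun_neg.fun_add (hasDerivAt_id' s)
    refine monotone_of_deriv_nonneg (fun s => (hd2 s).differentiableAt) fun s => ?_
    rw [(hd2 s).deriv]
    linarith [Real.cos_le_one (s + θ)]
  · have := Real.neg_one_le_cos (s + θ)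
    nlinarith [sq_nonneg s]
  · have hcos : Real.cos (x + θ) - Real.cos (y + θ) ≤ |x - y| := by
      have h := (Real.lipschitzWith_cos).dist_le_mul (x + θ) (y + θ)
      simp only [Real.dist_eq, NNReal.coe_one, one_mul, add_sub_add_right_eq_sub] at h
      exact (le_abs_self _).trans h
    have h1 : (x - y) * (x + y) ≤ |x - y| * (|x| + |y|) :=
      (le_abs_self _).trans (by rw [abs_mul]; gcongr; exact abs_add_le _ _)
    simp only [Real.norm_eq_abs]
    nlinarith [abs_nonneg (x - y), abs_nonneg x, abs_nonneg y,
      mul_nonneg (abs_nonneg (x - y)) (add_nonneg (abs_nonneg x) (abs_nonneg y))]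

/-- A convex replacement for the truncated second moment: tail bounds on the initial measures pass
to all later times by Jensen. -/
theorem quadraticConvex_excess {F : Type*} [NormedAddCommGroup F] [NormedSpace ℝ F] {R : ℝ}
    (hR : 0 ≤ R) : QuadraticConvex fun x : F => max (‖x‖ - R) 0 ^ 2 := by
  refine ⟨?_, by fun_prop, fun x => sq_nonneg _, 1, zero_le_one, fun x y => ?_⟩
  · have h1 : ConvexOn ℝ Set.univ fun x : F => max (‖x‖ - R) 0 := by
      have := ((convexOn_univ_norm (E := F)).add_const (-R)).sup (convexOn_const 0 convex_univ)
      exact this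
    exact h1.pow (fun x _ => le_max_right _ _) 2
  · have hx : max (‖x‖ - R) 0 ≤ ‖x‖ := max_le (by linarith) (norm_nonneg _)
    have hy : max (‖y‖ - R) 0 ≤ ‖y‖ := max_le (by linarith) (norm_nonneg _)
    have hxy : max (‖x‖ - R) 0 - max (‖y‖ - R) 0 ≤ ‖x - y‖ := by
      have h1 := norm_sub_norm_le x y
      rw [sub_le_iff_le_add]
      refine max_le ?_ (by positivity)
      linarith [le_max_left (‖y‖ - R) 0]
    have hx0 : 0 ≤ max (‖x‖ - R) 0 := le_max_right _ _
    have hy0 : 0 ≤ max (‖y‖ - R) 0 := le_max_right _ _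
    have h2 := mul_le_mul_of_nonneg_right hxy (add_nonneg hx0 hy0)
    have h3 := mul_le_mul_of_nonneg_left (add_le_add hx hy) (norm_nonneg (x - y))
    nlinarith [norm_nonneg (x - y)]

theorem tendsto_integral_excess {d : ℕ} {μ : Measure (EuclideanSpace ℝ (Fin d))}
    (hμ : μ ∈ WassersteinSpace d 2) :
    Tendsto (fun R : ℕ => ∫ x, max (‖x‖ - (R : ℝ)) 0 ^ 2 ∂μ) atTop (𝓝 0) := by
  have h := tendsto_integral_of_dominated_convergence (μ := μ)
    (F := fun (R : ℕ) x => max (‖x‖ - (R : ℝ)) 0 ^ 2) (f := fun _ => 0) (fun x => ‖x‖ ^ 2)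
    (fun R => (by fun_prop : Continuous fun x : EuclideanSpace ℝ (Fin d) =>
      max (‖x‖ - (R : ℝ)) 0 ^ 2).aestronglyMeasurable)
    (integrable_norm_sq hμ) (fun R => Eventually.of_forall fun x => ?_)
    (Eventually.of_forall fun x => ?_)
  · simpa using h
  · rw [Real.norm_of_nonneg (sq_nonneg _)]
    have hR : (0 : ℝ) ≤ R := Nat.cast_nonneg R
    exact pow_le_pow_left₀ (le_max_right _ _) (max_le (by linarith) (norm_nonneg _)) 2
  · refine tendsto_const_nhds.congr' ?_
    filter_upwards [eventually_ge_atTop ⌈‖x‖⌉₊] with R hR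
    have : ‖x‖ ≤ R := Nat.ceil_le.1 hR
    rw [max_eq_right (by linarith)]
    simp

/-! ### From weak convergence to convergence in `W₂`. -/

theorem measure_frontier_sdiff_eq_zero {α : Type*} [TopologicalSpace α] [MeasurableSpace α]
    [OpensMeasurableSpace α]
    {ν : Measure α} {s t : Set α} (hs : ν (frontier s) = 0) (ht : ν (frontier t) = 0) :
    ν (frontier (s \ t)) = 0 := by
  rw [Set.sdiff_eq]
  exact null_frontier_inter hs (by rwa [frontier_compl])

/-- Balls around a dense sequence, made disjoint. All but countably many radii give null frontiers;
radii above `ε / 4` make the balls cover and radii below `ε / 2` keep their diameters at most `ε`.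
-/
theorem exists_partition_null_frontier {α : Type*} [PseudoMetricSpace α]
    [TopologicalSpace.SeparableSpace α] [Nonempty α] [MeasurableSpace α] [OpensMeasurableSpace α]
    (ν : Measure α) [SFinite ν] {ε : ℝ} (hε : 0 < ε) :
    ∃ A : ℕ → Set α, (∀ k, MeasurableSet (A k)) ∧ (∀ k, ∀ x ∈ A k, ∀ y ∈ A k, dist x y ≤ ε) ∧
      ⋃ k, A k = Set.univ ∧ Pairwise (fun k l => Disjoint (A k) (A l)) ∧
      ∀ k, ν (frontier (A k)) = 0 := by
  have hr : ∀ k, ∃ r ∈ Set.Ioo (ε / 4) (ε / 2),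
      ν (frontier (Metric.thickening r {TopologicalSpace.denseSeq α k})) = 0 := fun k =>
    exists_null_frontier_thickening ν _ (by linarith)
  choose r hr hnull using hr
  set B : ℕ → Set α := fun k => Metric.thickening (r k) {TopologicalSpace.denseSeq α k} with hB
  refine ⟨disjointed B, MeasurableSet.disjointed fun k => Metric.isOpen_thickening.measurableSet,
    fun k x hx y hy => ?_, ?_, disjoint_disjointed B, fun k => ?_⟩
  · have hx' := disjointed_subset B k hx
    have hy' := disjointed_subset B k hy
    simp only [hB, Metric.thickening_singleton, Metric.mem_ball] at hx' hy'
    have := (hr k).2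
    linarith [dist_triangle_right x y (TopologicalSpace.denseSeq α k)]
  · rw [iUnion_disjointed]
    refine Set.eq_univ_of_forall fun x => ?_
    obtain ⟨k, hk⟩ := (TopologicalSpace.denseRange_denseSeq α).exists_dist_lt x
      (by linarith : (0 : ℝ) < ε / 4)
    refine Set.mem_iUnion.2 ⟨k, ?_⟩
    simp only [hB, Metric.thickening_singleton, Metric.mem_ball]
    exact hk.trans (hr k).1
  · exact disjointedRec (p := fun s => ν (frontier s) = 0)
      (fun t i ht => measure_frontier_sdiff_eq_zero ht (hnull i)) (hnull k)

/-- Two probability measures share, up to a remainder, a plan that stays in the cells of a given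
countable partition. -/
theorem exists_partial_plan {α : Type*} [MeasurableSpace α] (μ ν : Measure α)
    [IsProbabilityMeasure μ] [IsProbabilityMeasure ν] {A : ℕ → Set α}
    (hA : ∀ k, MeasurableSet (A k)) (hcover : ⋃ k, A k = Set.univ)
    (hdisj : Pairwise (fun k l => Disjoint (A k) (A l))) :
    ∃ (γ : Measure (α × α)) (μ' ν' : Measure α),
      γ.map Prod.fst + μ' = μ ∧ γ.map Prod.snd + ν' = ν ∧
        (∀ᵐ z ∂γ, ∃ k, z.1 ∈ A k ∧ z.2 ∈ A k) ∧
        γ Set.univ = ∑' k, min (μ (A k)) (ν (A k)) := by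
  -- Dividing the product of the restrictions by the larger cell mass leaves exactly the smaller one
  -- as common mass. Cells null for both measures contribute nothing, as `∞ * 0 = 0`.
  set M : ℕ → ℝ≥0∞ := fun k => max (μ (A k)) (ν (A k)) with hM
  have hle : ∀ a b : ℝ≥0∞, a ≤ b → b⁻¹ * a ≤ 1 := fun a b hab => by
    rw [mul_comm, ← div_eq_mul_inv]
    exact ENNReal.div_le_of_le_mul (by simpa using hab)
  have hsum : ∀ ρ : Measure α, Measure.sum (fun k => ρ.restrict (A k)) = ρ := fun ρ => by
    rw [← Measure.restrict_iUnion hdisj hA, hcover, Measure.restrict_univ]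
  refine ⟨Measure.sum fun k => (M k)⁻¹ • (μ.restrict (A k)).prod (ν.restrict (A k)),
    Measure.sum fun k => (1 - (M k)⁻¹ * ν (A k)) • μ.restrict (A k),
    Measure.sum fun k => (1 - (M k)⁻¹ * μ (A k)) • ν.restrict (A k), ?_, ?_, ?_, ?_⟩
  · rw [Measure.map_sum measurable_fst.aemeasurable, Measure.sum_add_sum]
    conv_rhs => rw [← hsum μ]
    congr 1
    ext1 k
    rw [Measure.map_smul, Measure.map_fst_prod]
    simp only [Measure.restrict_apply_univ]
    rw [smul_smul, ← add_smul, add_tsub_cancel_of_le (hle _ _ (le_max_right _ _)), one_smul]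
  · rw [Measure.map_sum measurable_snd.aemeasurable, Measure.sum_add_sum]
    conv_rhs => rw [← hsum ν]
    congr 1
    ext1 k
    rw [Measure.map_smul, Measure.map_snd_prod]
    simp only [Measure.restrict_apply_univ]
    rw [smul_smul, ← add_smul, add_tsub_cancel_of_le (hle _ _ (le_max_left _ _)), one_smul]
  · rw [Measure.ae_sum_iff]
    intro k
    refine Measure.ae_smul_measure ?_ _
    rw [Measure.prod_restrict]
    filter_upwards [ae_restrict_mem ((hA k).prod (hA k))] with z hz
    exact ⟨k, hz.1, hz.2⟩
  · rw [Measure.sum_apply _ MeasurableSet.univ]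
    refine tsum_congr fun k => ?_
    rw [Measure.smul_apply, ← Set.univ_prod_univ, Measure.prod_prod, Measure.restrict_apply_univ,
      Measure.restrict_apply_univ, smul_eq_mul]
    have hcancel : ∀ a b : ℝ≥0∞, a ≤ b → b ≠ ∞ → b⁻¹ * (a * b) = a := by
      intro a b hab hb
      rcases eq_or_ne b 0 with rfl | hb0
      · simp [nonpos_iff_eq_zero.1 hab]
      · rw [mul_comm, mul_assoc, ENNReal.mul_inv_cancel hb0 hb, mul_one]
    rcases le_total (μ (A k)) (ν (A k)) with h | h
    · rw [min_eq_left h, hM]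
      simp only [max_eq_right h]
      exact hcancel _ _ h (measure_ne_top _ _)
    · rw [min_eq_right h, hM]
      simp only [max_eq_left h]
      rw [mul_comm (μ (A k))]
      exact hcancel _ _ h (measure_ne_top _ _)

theorem enorm_sq_le_excess {F : Type*} [NormedAddCommGroup F] (R : ℝ) (x : F) :
    ‖x‖ₑ ^ 2 ≤ 2 * ENNReal.ofReal (R ^ 2) + 2 * ENNReal.ofReal (max (‖x‖ - R) 0 ^ 2) := by
  have h : ‖x‖ ^ 2 ≤ 2 * R ^ 2 + 2 * max (‖x‖ - R) 0 ^ 2 := by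
    have h1 : ‖x‖ ≤ R + max (‖x‖ - R) 0 := by linarith [le_max_left (‖x‖ - R) 0]
    have h2 := pow_le_pow_left₀ (norm_nonneg x) h1 2
    nlinarith [sq_nonneg (R - max (‖x‖ - R) 0)]
  rw [← ofReal_norm, ← ENNReal.ofReal_pow (norm_nonneg _),
    show (2 : ℝ≥0∞) = ENNReal.ofReal 2 by simp, ← ENNReal.ofReal_mul (by norm_num),
    ← ENNReal.ofReal_mul (by norm_num), ← ENNReal.ofReal_add (by positivity) (by positivity)]
  exact ENNReal.ofReal_le_ofReal h

/-- Mass shared within a cell moves at most `ε`. The remainders, of equal mass `r`, are coupled by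
their normalized product, whose cost is controlled by their second moments, each split at radius
`R`. -/
theorem wassersteinDist_two_sq_le_of_partition {d : ℕ}
    (μ ν : Measure (EuclideanSpace ℝ (Fin d)))
    [IsProbabilityMeasure μ] [IsProbabilityMeasure ν] {A : ℕ → Set (EuclideanSpace ℝ (Fin d))}
    (hA : ∀ k, MeasurableSet (A k)) (hcover : ⋃ k, A k = Set.univ)
    (hdisj : Pairwise (fun k l => Disjoint (A k) (A l))) {ε : ℝ}
    (hdiam : ∀ k, ∀ x ∈ A k, ∀ y ∈ A k, dist x y ≤ ε) (R : ℝ) :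
    wassersteinDist 2 μ ν ^ 2 ≤ ENNReal.ofReal ε ^ 2
      + 8 * ENNReal.ofReal (R ^ 2) * (1 - ∑' k, min (μ (A k)) (ν (A k)))
      + 4 * ∫⁻ x, ENNReal.ofReal (max (‖x‖ - R) 0 ^ 2) ∂μ
      + 4 * ∫⁻ x, ENNReal.ofReal (max (‖x‖ - R) 0 ^ 2) ∂ν := by
  obtain ⟨γ, μ', ν', hμ', hν', hγA, hγ⟩ := exists_partial_plan μ ν hA hcover hdisj
  have hμu : γ Set.univ + μ' Set.univ = 1 := by
    have := congrArg (fun ρ : Measure _ => ρ Set.univ) hμ'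
    simpa [Measure.map_apply measurable_fst MeasurableSet.univ] using this
  have hνu : γ Set.univ + ν' Set.univ = 1 := by
    have := congrArg (fun ρ : Measure _ => ρ Set.univ) hν'
    simpa [Measure.map_apply measurable_snd MeasurableSet.univ] using this
  have hγ1 : γ Set.univ ≤ 1 := hμu ▸ le_self_add
  have hγtop : γ Set.univ ≠ ∞ := (hγ1.trans_lt ENNReal.one_lt_top).ne
  set r := 1 - γ Set.univ with hr
  have hμr : μ' Set.univ = r := by rw [hr, ← hμu, ENNReal.add_sub_cancel_left hγtop]
  have hνr : ν' Set.univ = r := by rw [hr, ← hνu, ENNReal.add_sub_cancel_left hγtop]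
  have hrtop : r ≠ ∞ := (tsub_le_self.trans_lt ENNReal.one_lt_top).ne
  have hμfin : IsFiniteMeasure μ' := ⟨by rw [hμr]; exact hrtop.lt_top⟩
  have hνfin : IsFiniteMeasure ν' := ⟨by rw [hνr]; exact hrtop.lt_top⟩
  -- If `r = 0` the remainders are zero measures, so the value `r⁻¹ = ∞` is harmless.
  have hscale : ∀ ρ : Measure (EuclideanSpace ℝ (Fin d)), ρ Set.univ = r → r⁻¹ • r • ρ = ρ := by
    intro ρ hρ
    rcases eq_or_ne r 0 with h0 | h0
    · rw [h0, Measure.measure_univ_eq_zero] at hρ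
      simp [hρ]
    · rw [smul_smul, ENNReal.inv_mul_cancel h0 hrtop, one_smul]
  have hfst : (γ + r⁻¹ • μ'.prod ν').map Prod.fst = μ := by
    rw [Measure.map_add _ _ measurable_fst, Measure.map_smul, Measure.map_fst_prod, hνr,
      hscale μ' hμr, hμ']
  have hsnd : (γ + r⁻¹ • μ'.prod ν').map Prod.snd = ν := by
    rw [Measure.map_add _ _ measurable_snd, Measure.map_smul, Measure.map_snd_prod, hμr,
      hscale ν' hνr, hν']
  have hplan : γ + r⁻¹ • μ'.prod ν' ∈ transportPlans μ ν := by
    refine ⟨⟨?_⟩, hfst, hsnd⟩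
    have := congrArg (fun ρ : Measure _ => ρ Set.univ) hfst
    rwa [Measure.map_apply measurable_fst MeasurableSet.univ, Set.preimage_univ,
      measure_univ (μ := μ)] at this
  have hmoment : ∀ ρ ρ' : Measure (EuclideanSpace ℝ (Fin d)), ρ' ≤ ρ → ρ' Set.univ = r →
      ∫⁻ x, ‖x‖ₑ ^ 2 ∂ρ' ≤ 2 * ENNReal.ofReal (R ^ 2) * r
        + 2 * ∫⁻ x, ENNReal.ofReal (max (‖x‖ - R) 0 ^ 2) ∂ρ := by
    intro ρ ρ' hle hρ'
    calc ∫⁻ x, ‖x‖ₑ ^ 2 ∂ρ'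
        ≤ ∫⁻ x, (2 * ENNReal.ofReal (R ^ 2) + 2 * ENNReal.ofReal (max (‖x‖ - R) 0 ^ 2)) ∂ρ' :=
          lintegral_mono fun x => enorm_sq_le_excess R x
      _ = 2 * ENNReal.ofReal (R ^ 2) * r
          + 2 * ∫⁻ x, ENNReal.ofReal (max (‖x‖ - R) 0 ^ 2) ∂ρ' := by
        rw [lintegral_add_left measurable_const, lintegral_const, hρ',
          lintegral_const_mul _ (by fun_prop)]
      _ ≤ _ := by gcongr
  have hcostγ : ∫⁻ z, ‖z.1 - z.2‖ₑ ^ 2 ∂γ ≤ ENNReal.ofReal ε ^ 2 := by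
    calc ∫⁻ z, ‖z.1 - z.2‖ₑ ^ 2 ∂γ ≤ ∫⁻ _, ENNReal.ofReal ε ^ 2 ∂γ := by
          refine lintegral_mono_ae ?_
          filter_upwards [hγA] with z hz
          obtain ⟨k, h1, h2⟩ := hz
          rw [← ofReal_norm, ← dist_eq_norm]
          gcongr
          exact hdiam k _ h1 _ h2
      _ ≤ _ := by
        rw [lintegral_const]
        exact mul_le_of_le_one_right' hγ1
  have hcostprod : r⁻¹ * ∫⁻ z, ‖z.1 - z.2‖ₑ ^ 2 ∂(μ'.prod ν') ≤
      2 * ∫⁻ x, ‖x‖ₑ ^ 2 ∂μ' + 2 * ∫⁻ x, ‖x‖ₑ ^ 2 ∂ν' := by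
    have h1 : ∫⁻ z, ‖z.1 - z.2‖ₑ ^ 2 ∂(μ'.prod ν') ≤
        r * (2 * ∫⁻ x, ‖x‖ₑ ^ 2 ∂μ' + 2 * ∫⁻ x, ‖x‖ₑ ^ 2 ∂ν') := by
      calc ∫⁻ z, ‖z.1 - z.2‖ₑ ^ 2 ∂(μ'.prod ν')
          ≤ ∫⁻ z, (2 * ‖z.1‖ₑ ^ 2 + 2 * ‖z.2‖ₑ ^ 2) ∂(μ'.prod ν') :=
            lintegral_mono fun z => enorm_sub_sq_le _ _
        _ = _ := by
          rw [lintegral_add_left (by fun_prop), lintegral_const_mul _ (by fun_prop),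
            lintegral_const_mul _ (by fun_prop),
            ← lintegral_map (f := fun x : EuclideanSpace ℝ (Fin d) => ‖x‖ₑ ^ 2) (by fun_prop)
              measurable_fst,
            ← lintegral_map (f := fun x : EuclideanSpace ℝ (Fin d) => ‖x‖ₑ ^ 2) (by fun_prop)
              measurable_snd, Measure.map_fst_prod, Measure.map_snd_prod, hμr, hνr,
            lintegral_smul_measure, lintegral_smul_measure, smul_eq_mul, smul_eq_mul]
          ring
    refine (mul_le_mul_right h1 _).trans ?_
    rw [← mul_assoc]
    exact mul_le_of_le_one_left' (ENNReal.inv_mul_le_one r)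
  calc wassersteinDist 2 μ ν ^ 2 ≤ ∫⁻ z, ‖z.1 - z.2‖ₑ ^ 2 ∂(γ + r⁻¹ • μ'.prod ν') :=
        wassersteinDist_two_sq_le hplan
    _ = ∫⁻ z, ‖z.1 - z.2‖ₑ ^ 2 ∂γ + r⁻¹ * ∫⁻ z, ‖z.1 - z.2‖ₑ ^ 2 ∂(μ'.prod ν') := by
      rw [lintegral_add_measure, lintegral_smul_measure, smul_eq_mul]
    _ ≤ ENNReal.ofReal ε ^ 2
        + (2 * (2 * ENNReal.ofReal (R ^ 2) * r
            + 2 * ∫⁻ x, ENNReal.ofReal (max (‖x‖ - R) 0 ^ 2) ∂μ)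
          + 2 * (2 * ENNReal.ofReal (R ^ 2) * r
            + 2 * ∫⁻ x, ENNReal.ofReal (max (‖x‖ - R) 0 ^ 2) ∂ν)) := by
      refine add_le_add hcostγ (hcostprod.trans ?_)
      gcongr
      · exact hmoment μ μ' (hμ' ▸ Measure.le_add_left le_rfl) hμr
      · exact hmoment ν ν' (hν' ▸ Measure.le_add_left le_rfl) hνr
    _ = _ := by
      rw [← hγ]
      ring

theorem lintegral_le_of_tendsto_of_forall_le {α : Type*} [PseudoMetricSpace α] [MeasurableSpace α]
    [OpensMeasurableSpace α] {μ : ℕ → ProbabilityMeasure α} {ν : ProbabilityMeasure α}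
    (h : Tendsto μ atTop (𝓝 ν)) {f : α → ℝ} (hf : Continuous f) (hf0 : 0 ≤ f) {c : ℝ≥0∞}
    (hc : ∀ t, ∫⁻ x, ENNReal.ofReal (f x) ∂(μ t : Measure α) ≤ c) :
    ∫⁻ x, ENNReal.ofReal (f x) ∂(ν : Measure α) ≤ c := by
  refine (lintegral_le_liminf_lintegral_of_forall_isOpen_measure_le_liminf_measure
    (μs := fun t => (μ t : Measure α)) hf hf0 fun G hG =>
      ProbabilityMeasure.le_liminf_measure_open_of_tendsto h hG).trans ?_
  exact (liminf_le_liminf (Eventually.of_forall hc)).trans (by simp)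

/-- Weak convergence and uniform integrability of the second moments imply convergence in `W₂`. -/
theorem tendsto_wassersteinDist_two {d : ℕ} {μ : ℕ → ProbabilityMeasure (EuclideanSpace ℝ (Fin d))}
    {ν : ProbabilityMeasure (EuclideanSpace ℝ (Fin d))} (h : Tendsto μ atTop (𝓝 ν))
    (hui : ∀ e : ℝ≥0∞, 0 < e → ∃ R : ℝ, ∀ t,
      ∫⁻ x, ENNReal.ofReal (max (‖x‖ - R) 0 ^ 2) ∂(μ t : Measure (EuclideanSpace ℝ (Fin d))) ≤ e) :
    Tendsto (fun t => wassersteinDist 2 (μ t : Measure (EuclideanSpace ℝ (Fin d))) ν)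
      atTop (𝓝 0) := by
  have hsq : Tendsto (fun t => wassersteinDist 2 (μ t : Measure (EuclideanSpace ℝ (Fin d))) ν ^ 2)
      atTop (𝓝 0) := by
    rw [ENNReal.tendsto_nhds_zero]
    intro e he
    -- The tail integrals enter the partition bound with factor `4`, so `e / 16` makes each of its
    -- four terms at most `e / 4`.
    have he4 : 0 < e / 16 := ENNReal.div_pos he.ne' (by norm_num)
    obtain ⟨R, hRμ⟩ := hui (e / 16) he4
    have hRν : ∫⁻ x, ENNReal.ofReal (max (‖x‖ - R) 0 ^ 2)
        ∂(ν : Measure (EuclideanSpace ℝ (Fin d))) ≤ e / 16 :=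
      lintegral_le_of_tendsto_of_forall_le h
        (((continuous_norm.sub continuous_const).max continuous_const).pow 2)
        (fun x => sq_nonneg _) hRμ
    obtain ⟨ε, hε, hεe⟩ : ∃ ε : ℝ, 0 < ε ∧ ENNReal.ofReal ε ^ 2 ≤ e / 4 := by
      have hc : Tendsto (fun ε : ℝ => ENNReal.ofReal ε ^ 2) (𝓝[>] 0) (𝓝 0) := by
        have : Continuous fun ε : ℝ => ENNReal.ofReal ε ^ 2 :=
          (ENNReal.continuous_pow 2).comp ENNReal.continuous_ofReal
        have h0 := this.tendsto 0
        simp only [ENNReal.ofReal_zero, ne_eq, OfNat.ofNat_ne_zero, not_false_eq_true,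
          zero_pow] at h0
        exact h0.mono_left nhdsWithin_le_nhds
      have := (ENNReal.tendsto_nhds_zero.1 hc (e / 4) (ENNReal.div_pos he.ne' (by norm_num))).and
        self_mem_nhdsWithin
      obtain ⟨ε, h1, h2⟩ := this.exists
      exact ⟨ε, h2, h1⟩
    obtain ⟨A, hA, hdiam, hcover, hdisj, hnull⟩ :=
      exists_partition_null_frontier (ν : Measure (EuclideanSpace ℝ (Fin d))) hε
    have hνsum : ∑' k, (ν : Measure (EuclideanSpace ℝ (Fin d))) (A k) = 1 := by
      rw [← measure_iUnion hdisj hA, hcover, measure_univ]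
    have hlim : Tendsto (fun t => ∑' k, min ((μ t : Measure (EuclideanSpace ℝ (Fin d))) (A k))
        ((ν : Measure _) (A k))) atTop (𝓝 1) := by
      -- Dominated convergence for the counting measure on cells: null frontiers give convergence
      -- cell by cell, and the masses `ν (A k)` are a summable majorant.
      have hdc := tendsto_lintegral_of_dominated_convergence (μ := Measure.count)
        (F := fun (t : ℕ) (k : ℕ) => min ((μ t : Measure (EuclideanSpace ℝ (Fin d))) (A k))
          ((ν : Measure _) (A k))) (f := fun k => (ν : Measure _) (A k))
        (fun k => (ν : Measure _) (A k)) (fun t => measurable_of_countable _)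
        (fun t => Eventually.of_forall fun k => min_le_right _ _)
        (by rw [lintegral_count, hνsum]; exact ENNReal.one_ne_top)
        (Eventually.of_forall fun k => by
          have := (ProbabilityMeasure.tendsto_measure_of_null_frontier_of_tendsto' h
            (hnull k)).min (tendsto_const_nhds (x := (ν : Measure _) (A k)))
          simpa using this)
      simpa only [lintegral_count, hνsum] using hdc
    have hrem : Tendsto (fun t => 8 * ENNReal.ofReal (R ^ 2) *
        (1 - ∑' k, min ((μ t : Measure (EuclideanSpace ℝ (Fin d))) (A k))
          ((ν : Measure _) (A k)))) atTop (𝓝 0) := by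
      have h1 := ENNReal.Tendsto.sub (tendsto_const_nhds (x := (1 : ℝ≥0∞))) hlim
        (Or.inl ENNReal.one_ne_top)
      rw [tsub_self] at h1
      have h2 := ENNReal.Tendsto.const_mul (a := 8 * ENNReal.ofReal (R ^ 2)) h1
        (Or.inr (by finiteness))
      simpa using h2
    filter_upwards [ENNReal.tendsto_nhds_zero.1 hrem (e / 4)
      (ENNReal.div_pos he.ne' (by norm_num))] with t ht
    have hq : 4 * (e / 16) = e / 4 := by
      rw [div_eq_mul_inv, div_eq_mul_inv, mul_left_comm]
      congr 1
      rw [show (16 : ℝ≥0∞) = 4 * 4 by norm_num, ENNReal.mul_inv (by simp) (by simp), ← mul_assoc,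
        ENNReal.mul_inv_cancel (by simp) (by simp), one_mul]
    have hsum4 : e / 4 + e / 4 + e / 4 + e / 4 = e := by
      rw [ENNReal.div_add_div_same, ENNReal.div_add_div_same, ENNReal.div_add_div_same]
      rw [show e + e + e + e = e * 4 by ring, ENNReal.mul_div_cancel_right (by simp) (by simp)]
    calc wassersteinDist 2 (μ t : Measure (EuclideanSpace ℝ (Fin d))) ν ^ 2
        ≤ _ := wassersteinDist_two_sq_le_of_partition _ _ hA hcover hdisj hdiam R
      _ ≤ e / 4 + e / 4 + 4 * (e / 16) + 4 * (e / 16) := by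
        gcongr
        exact hRμ t
      _ = e := by rw [hq, hsum4]
  have hroot := ((ENNReal.continuous_rpow_const (y := (2 : ℝ)⁻¹)).tendsto 0).comp hsq
  simp only [ENNReal.zero_rpow_of_pos (show (0 : ℝ) < 2⁻¹ by norm_num)] at hroot
  refine hroot.congr fun t => ?_
  simp only [Function.comp_apply]
  rw [← ENNReal.rpow_natCast, ← ENNReal.rpow_mul]
  norm_num

/-! ### Tightness, characteristic functions and conclusion. -/

theorem wassersteinSpace_anti {d : ℕ} {p q : ℝ} (hp : 0 ≤ p) (hpq : p ≤ q) :
    WassersteinSpace d q ⊆ WassersteinSpace d p := by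
  rintro μ ⟨hμ, hq⟩
  refine ⟨hμ, ?_⟩
  calc ∫⁻ x, ‖x‖ₑ ^ p ∂μ ≤ ∫⁻ x, (1 + ‖x‖ₑ ^ q) ∂μ := by
        refine lintegral_mono fun x => ?_
        rcases le_total ‖x‖ₑ 1 with h | h
        · exact (ENNReal.rpow_le_one h hp).trans le_self_add
        · exact (ENNReal.rpow_le_rpow_of_exponent_le h hpq).trans le_add_self
    _ = 1 + ∫⁻ x, ‖x‖ₑ ^ q ∂μ := by
        rw [lintegral_add_left measurable_const, lintegral_const, measure_univ, mul_one]
    _ < ∞ := by finiteness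

/-- Chebyshev's inequality: the mass outside radius `r` is at most `C / r²`. -/
theorem isTightMeasureSet_of_lintegral_enorm_sq_le {F : Type*} [NormedAddCommGroup F]
    [ProperSpace F] [MeasurableSpace F] [BorelSpace F] {S : Set (Measure F)} {C : ℝ≥0∞}
    (hC : C ≠ ∞) (hS : ∀ μ ∈ S, ∫⁻ x, ‖x‖ₑ ^ 2 ∂μ ≤ C) : IsTightMeasureSet S := by
  refine isTightMeasureSet_of_tendsto_measure_norm_gt ?_
  have hlim : Tendsto (fun r : ℝ => C / ENNReal.ofReal r ^ 2) atTop (𝓝 0) := by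
    have h1 : Tendsto (fun r : ℝ => ENNReal.ofReal r ^ 2) atTop (𝓝 ∞) := by
      have := ((ENNReal.continuous_pow 2).tendsto ∞).comp ENNReal.tendsto_ofReal_atTop
      simpa using! this
    simpa using ENNReal.Tendsto.const_div h1 (Or.inr hC)
  refine tendsto_of_tendsto_of_tendsto_of_le_of_le' tendsto_const_nhds hlim
    (Eventually.of_forall fun _ => zero_le) ?_
  filter_upwards [eventually_gt_atTop 0] with r hr
  refine iSup₂_le fun μ hμ => ?_
  have hsub : {x : F | r < ‖x‖} ⊆ {x | ENNReal.ofReal r ^ 2 ≤ ‖x‖ₑ ^ 2} := by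
    intro x hx
    change ENNReal.ofReal r ^ 2 ≤ ‖x‖ₑ ^ 2
    rw [← ofReal_norm]
    gcongr
    exact le_of_lt hx
  refine (measure_mono hsub).trans ?_
  refine (meas_ge_le_lintegral_div (by fun_prop) (by simpa using hr) (by finiteness)).trans ?_
  gcongr
  exact hS μ hμ

theorem charFun_eq_integral_cos {F : Type*} [NormedAddCommGroup F] [InnerProductSpace ℝ F]
    [MeasurableSpace F] [BorelSpace F] (μ : Measure F) [IsFiniteMeasure μ]
    [SecondCountableTopology F] (u : F) :
    charFun μ u = ((∫ x, Real.cos (inner ℝ x u + 0) ∂μ : ℝ) : ℂ)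
      + ((∫ x, Real.cos (inner ℝ x u + -(Real.pi / 2)) ∂μ : ℝ) : ℂ) * Complex.I := by
  have hint : ∀ θ : ℝ, Integrable (fun x : F => Real.cos (inner ℝ x u + θ)) μ := fun θ =>
    (integrable_const (1 : ℝ)).mono' (by fun_prop) (Eventually.of_forall fun x =>
      Real.abs_cos_le_one _)
  rw [charFun_apply, ← integral_complex_ofReal, ← integral_complex_ofReal, ← integral_mul_const,
    ← integral_add (hint _).ofReal ((hint _).ofReal.mul_const _)]
  refine integral_congr_ae (Eventually.of_forall fun x => ?_)
  simp only [add_zero]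
  rw [← sub_eq_add_neg, Real.cos_sub_pi_div_two, Complex.exp_mul_I]
  push_cast
  rfl

/-- Convergence of the integrals of all `QuadraticConvex` functions, jointly for a family of
sequences, forces convergence of the characteristic functions to a common limit. -/
theorem exists_tendsto_charFun {d : ℕ} {ι : Type*}
    {μ : ℕ → ι → Measure (EuclideanSpace ℝ (Fin d))} (hμ : ∀ t i, μ t i ∈ WassersteinSpace d 2)
    (hconv : ∀ f : EuclideanSpace ℝ (Fin d) → ℝ, QuadraticConvex f →
      ∃ M, ∀ i, Tendsto (fun t => ∫ x, f x ∂(μ t i)) atTop (𝓝 M))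
    (u : EuclideanSpace ℝ (Fin d)) :
    ∃ z, ∀ i, Tendsto (fun t => charFun (μ t i) u) atTop (𝓝 z) := by
  have hp : ∀ t i, IsProbabilityMeasure (μ t i) := fun t i =>
    (mem_wassersteinSpace_two.1 (hμ t i)).1
  have hcos : ∀ θ : ℝ, ∃ M, ∀ i,
      Tendsto (fun t => ∫ x, Real.cos (inner ℝ x u + θ) ∂(μ t i)) atTop (𝓝 M) := by
    intro θ
    have hg := (quadraticConvex_cos θ).comp_inner u
    have hs := quadraticConvex_half_sq.comp_inner u
    obtain ⟨M₁, h₁⟩ := hconv _ hg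
    obtain ⟨M₂, h₂⟩ := hconv _ hs
    refine ⟨M₁ - M₂ - 1, fun i => (((h₁ i).sub (h₂ i)).sub_const 1).congr fun t => ?_⟩
    rw [← integral_sub (hg.integrable (hμ t i)) (hs.integrable (hμ t i)), sub_eq_iff_eq_add]
    have hint : Integrable (fun x : EuclideanSpace ℝ (Fin d) => Real.cos (inner ℝ x u + θ))
        (μ t i) :=
      (integrable_const (1 : ℝ)).mono' (by fun_prop) (Eventually.of_forall fun x =>
        Real.abs_cos_le_one _)
    have hone : (1 : ℝ) = ∫ _, (1 : ℝ) ∂(μ t i) := by simp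
    conv_rhs => rw [hone]
    rw [← integral_add hint (integrable_const _)]
    exact integral_congr_ae (Eventually.of_forall fun x => by ring)
  obtain ⟨M₁, h₁⟩ := hcos 0
  obtain ⟨M₂, h₂⟩ := hcos (-(Real.pi / 2))
  refine ⟨(M₁ : ℂ) + (M₂ : ℂ) * Complex.I, fun i => ?_⟩
  simp only [charFun_eq_integral_cos]
  exact ((Complex.continuous_ofReal.tendsto M₁).comp (h₁ i)).add
    (((Complex.continuous_ofReal.tendsto M₂).comp (h₂ i)).mul_const _)

theorem QuadraticConvex.lintegral_ofReal_eq {d : ℕ} {f : EuclideanSpace ℝ (Fin d) → ℝ}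
    (hf : QuadraticConvex f) {μ : Measure (EuclideanSpace ℝ (Fin d))}
    (hμ : μ ∈ WassersteinSpace d 2) :
    ∫⁻ x, ENNReal.ofReal (f x) ∂μ = ENNReal.ofReal (∫ x, f x ∂μ) :=
  (ofReal_integral_eq_lintegral_ofReal (hf.integrable hμ) (Eventually.of_forall hf.nonneg)).symm

/-- Sequences of measures along which the integrals of `QuadraticConvex` functions converge to
common limits, with uniformly integrable second moments, converge in `W₂` to a common limit. -/
theorem exists_common_limit {d : ℕ} {ι : Type*} [Nonempty ι]
    {μ : ℕ → ι → ProbabilityMeasure (EuclideanSpace ℝ (Fin d))}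
    (hμ : ∀ t i, (μ t i : Measure (EuclideanSpace ℝ (Fin d))) ∈ WassersteinSpace d 2)
    (hconv : ∀ f : EuclideanSpace ℝ (Fin d) → ℝ, QuadraticConvex f →
      ∃ M, ∀ i, Tendsto (fun t => ∫ x, f x ∂(μ t i : Measure (EuclideanSpace ℝ (Fin d))))
        atTop (𝓝 M))
    (hui : ∀ i (e : ℝ≥0∞), 0 < e → ∃ R : ℝ, ∀ t, ∫⁻ x, ENNReal.ofReal (max (‖x‖ - R) 0 ^ 2)
      ∂(μ t i : Measure (EuclideanSpace ℝ (Fin d))) ≤ e)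
    {C : ℝ≥0∞} (hC : C ≠ ∞)
    (hbound : ∀ t i, ∫⁻ x, ENNReal.ofReal (‖x‖ ^ 2)
      ∂(μ t i : Measure (EuclideanSpace ℝ (Fin d))) ≤ C) :
    ∃ μstar ∈ WassersteinSpace d 2, ∀ i, Tendsto
      (fun t => wassersteinDist 2 (μ t i : Measure (EuclideanSpace ℝ (Fin d))) μstar)
      atTop (𝓝 0) := by
  obtain ⟨i₀⟩ := ‹Nonempty ι›
  have hnorm : ∀ x : EuclideanSpace ℝ (Fin d), ENNReal.ofReal (‖x‖ ^ 2) = ‖x‖ₑ ^ 2 := fun x => by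
    rw [ENNReal.ofReal_pow (norm_nonneg _), ofReal_norm]
  have htight : IsTightMeasureSet {((ν : ProbabilityMeasure (EuclideanSpace ℝ (Fin d))) :
      Measure (EuclideanSpace ℝ (Fin d))) | ν ∈ Set.range fun t => μ t i₀} := by
    refine isTightMeasureSet_of_lintegral_enorm_sq_le hC ?_
    rintro _ ⟨_, ⟨t, rfl⟩, rfl⟩
    simpa only [hnorm] using hbound t i₀
  obtain ⟨μstar, -, φ, hφ, hlim⟩ := (isCompact_closure_of_isTightMeasureSet htight).tendsto_subseq
    (x := fun t => μ t i₀) fun t => subset_closure ⟨t, rfl⟩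
  -- A subsequence for one agent only serves to identify the limit: the characteristic functions
  -- already converge along the whole sequence, to the same value for every agent.
  have hweak : ∀ i, Tendsto (fun t => μ t i) atTop (𝓝 μstar) := by
    intro i
    refine ProbabilityMeasure.tendsto_of_tendsto_charFun fun u => ?_
    obtain ⟨z, hz⟩ := exists_tendsto_charFun hμ hconv u
    have hz0 := ProbabilityMeasure.tendsto_iff_tendsto_charFun.1 hlim u
    rw [tendsto_nhds_unique hz0 ((hz i₀).comp hφ.tendsto_atTop)]
    exact hz i
  refine ⟨μstar, mem_wassersteinSpace_two.2 ⟨inferInstance, ?_⟩, fun i =>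
    tendsto_wassersteinDist_two (hweak i) (hui i)⟩
  have := lintegral_le_of_tendsto_of_forall_le (hweak i₀) (f := fun x => ‖x‖ ^ 2)
    (by fun_prop) (fun x => sq_nonneg _) fun t => hbound t i₀
  simp only [hnorm] at this
  exact this.trans_lt hC.lt_top

theorem theorem2 (n d : ℕ) (hn : 0 < n) (hd : 0 < d)
    -- the undirected links, with a self-link at every agent
    (E : ℕ → Set (Fin n × Fin n))
    (hE_symm : ∀ t i j, (i, j) ∈ E t → (j, i) ∈ E t)
    (hE_self : ∀ t i, (i, i) ∈ E t)
    -- the weights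
    (w : ℕ → Matrix (Fin n) (Fin n) ℝ)
    (hw_pos : ∀ t i j, (i, j) ∈ E t ↔ 0 < w t i j)
    (hw_zero : ∀ t i j, (i, j) ∉ E t → w t i j = 0)
    (hw_sum : ∀ t i, ∑ j ∈ neighbors (E t) i, w t i j = 1)
    (δ : ℝ) (hδ : δ ∈ Set.Ioo (0 : ℝ) 1)
    (hw_lower : ∀ t i, ∀ j ∈ neighbors (E t) i, δ ≤ w t i j)
    -- joint connectivity over consecutive time windows of bounded length
    (τ : ℕ → ℕ) (hτ_zero : τ 0 = 0) (hτ_mono : StrictMono τ)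
    (L : ℕ) (hτ_bdd : ∀ k, τ (k + 1) - τ k ≤ L)
    (h_conn : ∀ k, JointlyConnected E (Set.Ico (τ k) (τ (k + 1))))
    -- the barycenter consensus dynamics `μ t i = μ_i(t)`
    (μ : ℕ → Fin n → Measure (EuclideanSpace ℝ (Fin d)))
    (q : ℝ) (hq : 2 < q)
    (h_init : ∀ i, μ 0 i ∈ WassersteinSpaceAC d q)
    (h_update : ∀ t i, μ (t + 1) i ∈ barycenters (neighbors (E t) i) (μ t) (w t i)) :
    ∃ μstar ∈ WassersteinSpace d 2,
      ∀ i, Tendsto (fun t => wassersteinDist 2 (μ t i) μstar) atTop (𝓝 0) := by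
  have hmem : ∀ t i, μ t i ∈ WassersteinSpace d 2 := by
    intro t i
    cases t with
    | zero => exact wassersteinSpace_anti zero_le_two hq.le (h_init i).1
    | succ t => exact (h_update t i).1
  have hp : ∀ t i, IsProbabilityMeasure (μ t i) := fun t i =>
    (mem_wassersteinSpace_two.1 (hmem t i)).1
  have hcons : ∀ f : EuclideanSpace ℝ (Fin d) → ℝ, QuadraticConvex f →
      (∀ t i c, (∀ j, ∫ x, f x ∂(μ 0 j) ≤ c) → ∫ x, f x ∂(μ t i) ≤ c) ∧
        ∃ M, ∀ i, Tendsto (fun t => ∫ x, f x ∂(μ t i)) atTop (𝓝 M) := fun f hf =>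
    tendsto_of_le_weighted_sum hn E hE_symm hE_self w hw_sum δ hδ hw_lower τ hτ_zero hτ_mono L
      hτ_bdd h_conn (fun t i => ∫ x, f x ∂(μ t i)) (fun t i => integral_nonneg hf.nonneg)
      fun t i => hf.integral_barycenter_le (h_update t i) (hmem t)
        (fun j hj => hδ.1.le.trans (hw_lower t i j hj)) (hw_sum t i)
  have hui : ∀ i (e : ℝ≥0∞), 0 < e → ∃ R : ℝ, ∀ t,
      ∫⁻ x, ENNReal.ofReal (max (‖x‖ - R) 0 ^ 2) ∂(μ t i) ≤ e := by
    intro i e he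
    obtain ⟨c, hc0, hce⟩ := exists_between he
    have hctop : c ≠ ∞ := (hce.trans_le le_top).ne
    -- One `R` serves all of the finitely many initial measures; the maximum principle then carries
    -- the bound to every time.
    obtain ⟨R, hR⟩ := (eventually_all.2 fun j => (tendsto_integral_excess (hmem 0 j)).eventually_le_const
      (ENNReal.toReal_pos hc0.ne' hctop)).exists
    refine ⟨R, fun t => ?_⟩
    have hf := quadraticConvex_excess (F := EuclideanSpace ℝ (Fin d)) (Nat.cast_nonneg (α := ℝ) R)
    rw [hf.lintegral_ofReal_eq (hmem t i)]
    exact (ENNReal.ofReal_le_of_le_toReal ((hcons _ hf).1 t i _ hR)).trans hce.le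
  obtain ⟨C, hC⟩ : ∃ C : ℝ≥0∞, C ≠ ∞ ∧ ∀ t i, ∫⁻ x, ENNReal.ofReal (‖x‖ ^ 2) ∂(μ t i) ≤ C := by
    have hf : QuadraticConvex fun x : EuclideanSpace ℝ (Fin d) => ‖x‖ ^ 2 := by
      -- The squared norm is the excess function with `R = 0`.
      simpa using quadraticConvex_excess (F := EuclideanSpace ℝ (Fin d)) le_rfl
    obtain ⟨c, hc⟩ := (Set.finite_range fun j => ∫ x, ‖x‖ ^ 2 ∂(μ 0 j)).bddAbove
    refine ⟨ENNReal.ofReal c, ENNReal.ofReal_ne_top, fun t i => ?_⟩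
    rw [hf.lintegral_ofReal_eq (hmem t i)]
    exact ENNReal.ofReal_le_ofReal ((hcons _ hf).1 t i c fun j => hc ⟨j, rfl⟩)
  have hne : Nonempty (Fin n) := ⟨⟨0, hn⟩⟩
  exact exists_common_limit (μ := fun t i => ⟨μ t i, hp t i⟩) hmem (fun f hf => (hcons f hf).2)
    hui hC.1 hC.2
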